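/- Let $\mathbb A$ be a Noetherian commutative ring with identity. Let $X,Y$ be topological spaces, each homeomorphic to a closed subspace of some $\mathbb R^N$, with $Y$ path-connected, and let $f:X\to Y$ be a continuous proper map. Let $U\subseteq Y$ be a non-empty open subset such that $f$ induces a homeomorphism $f^{-1}(U)\cong U$, and put $W=Y\setminus U$, $\widetilde W=f^{-1}(W)$. Denote by $\mathbb A_V$ the constant sheaf on a space $V$; the sheaves $\mathbb A_W$ and $\mathbb A_{\widetilde W}$ are regarded as sheaves on $Y$ and $X$ by direct image along the closed inclusions, and sheaves are regarded as complexes in degree $0$. A morphism $\theta:Rf_*\mathbb A_X\to\mathbb A_Y$ in the derived category of sheaves of $\mathbb A$-modules on $Y$ (a bivariant class) induces a Gysin morphism $\theta_0:H^0(X)\to H^0(Y)$ on cohomology with coefficients in $\mathbb A$, where $H^0(X)=H^0(Y,Rf_*\mathbb A_X)$; $\theta$ has degree one if $\theta_0(1_X)=1_Y$. The following are equivalent in the bounded below derived category $D^+(Y)$ of sheaves of $\mathbb A$-modules on $Y$: (i) there exists a morphism $\theta: Rf_*\mathbb A_X\to\mathbb A_Y$ of degree one; (ii) there exists an isomorphism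 $Rf_*\mathbb A_X\oplus\mathbb A_W\cong Rf_*\mathbb A_{\widetilde W}\oplus\mathbb A_Y$; (iii) there exist an object $\mathcal K$ and an isomorphism $Rf_*\mathbb A_X\cong\mathbb A_Y\oplus\mathcal K$. Let $D^b_c(Y)\subseteq D^+(Y)$ be the full subcategory of complexes with bounded cohomology whose cohomology sheaves are constructible, i.e. locally constant with finitely generated stalks on each member of some locally finite partition of $Y$ into locally closed subspaces. If $Rf_*\mathbb A_X$ belongs to $D^b_c(Y)$, then so do $\mathbb A_Y$, $\mathbb A_W$, $Rf_*\mathbb A_{\widetilde W}$ and every $\mathcal K$ as in (iii); hence (i), (ii), (iii) are then equivalent in $D^b_c(Y)$. -/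

import Mathlib

open CategoryTheory CategoryTheory.Limits TopologicalSpace Topology Opposite

universe u

namespace Bivariant

noncomputable section

/-- `V` is homeomorphic to a closed subspace of some Euclidean space `ℝ^N`. -/
def ClosedInEuclidean (V : Type u) [TopologicalSpace V] : Prop :=
  ∃ (N : ℕ) (e : V → EuclideanSpace ℝ (Fin N)), IsClosedEmbedding e

/-- The category of sheaves of `A`-modules on a topological space `V`. -/
abbrev Sh (A : Type u) [CommRing A] (V : TopCat.{u}) := TopCat.Sheaf (ModuleCat.{u} A) V

instance hasDerivedCategorySh (A : Type u) [CommRing A] (V : TopCat.{u}) :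
    HasDerivedCategory (Sh A V) :=
  HasDerivedCategory.standard (Sh A V)

/-- The bounded below derived category `D⁺(V)` of sheaves of `A`-modules on `V`. -/
abbrev DPlus (A : Type u) [CommRing A] (V : TopCat.{u}) := DerivedCategory.Plus (Sh A V)

/-- A sheaf, seen as an object of `D⁺(V)` concentrated in degree `0`. -/
abbrev inDegreeZero (A : Type u) [CommRing A] (V : TopCat.{u}) : Sh A V ⥤ DPlus A V :=
  DerivedCategory.Plus.singleFunctor (Sh A V) 0

/-- The constant sheaf on `V` with value an `A`-module `M`. -/
abbrev constSheafOf {A : Type u} [CommRing A] (M : ModuleCat.{u} A) (V : TopCat.{u}) : Sh A V :=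
  (constantSheaf (Opens.grothendieckTopology V) (ModuleCat.{u} A)).obj M

/-- The constant sheaf `A_V`. -/
abbrev constSheaf (A : Type u) [CommRing A] (V : TopCat.{u}) : Sh A V :=
  constSheafOf (ModuleCat.of A A) V

/-- The module `H⁰(V) = Γ(V, A_V)`. -/
abbrev H0 (A : Type u) [CommRing A] (V : TopCat.{u}) : ModuleCat.{u} A :=
  (constSheaf A V).presheaf.obj (op ⊤)

/-- The unit class `1_V ∈ H⁰(V)`: the global section of the constant sheaf `A_V`
given by the element `1` of `A`. -/
def oneClass (A : Type u) [CommRing A] (V : TopCat.{u}) : H0 A V :=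
  ((constantSheafAdj (Opens.grothendieckTopology V) (ModuleCat.{u} A)
    (isTerminalTop : IsTerminal (⊤ : Opens V))).unit.app (ModuleCat.of A A)).hom (1 : A)

section Pushforward

variable (A : Type u) [CommRing A] {V Z : TopCat.{u}} (f : V ⟶ Z)

/-- The direct image functor `f_*` on sheaves of `A`-modules. -/
abbrev push : Sh A V ⥤ Sh A Z := TopCat.Sheaf.pushforward (ModuleCat.{u} A) f

instance push_additive : (push A f).Additive where
  map_add := rfl

/-- The inverse image functor `f⁻¹` on sheaves of `A`-modules. -/
abbrev pull : Sh A Z ⥤ Sh A V := TopCat.Sheaf.pullback (ModuleCat.{u} A) f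

/-- The total right derived functor `Rf_* : D⁺(V) ⥤ D⁺(Z)` of `f_*`. -/
abbrev Rpush : DPlus A V ⥤ DPlus A Z := (push A f).rightDerivedFunctorPlus

/-- The canonical morphism `f_* F ⟶ Rf_* F` in `D⁺(Z)`, for a sheaf `F` on `V`: it is given by the
natural transformation which is part of the data of a right derived functor. It induces an
isomorphism on `H⁰`. -/
def pushToRpush (F : Sh A V) :
    (inDegreeZero A Z).obj ((push A f).obj F) ⟶ (Rpush A f).obj ((inDegreeZero A V).obj F) :=
  (DerivedCategory.Plus.ι.preimageIso
    (X := (inDegreeZero A Z).obj ((push A f).obj F))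
    (Y := DerivedCategory.Plus.Qh.obj ((push A f).mapHomotopyCategoryPlus.obj
      ((HomotopyCategory.Plus.singleFunctor (Sh A V) 0).obj F)))
    (DerivedCategory.Q.mapIso
      ((HomologicalComplex.singleMapHomologicalComplex (push A f)
        (ComplexShape.up ℤ) 0).app F).symm)).hom ≫
  (push A f).rightDerivedFunctorPlusUnit.app
    ((HomotopyCategory.Plus.singleFunctor (Sh A V) 0).obj F)

end Pushforward

instance inDegreeZero_full (A : Type u) [CommRing A] (V : TopCat.{u}) :
    (inDegreeZero A V).Full :=
  have : (inDegreeZero A V ⋙ DerivedCategory.Plus.ι).Full :=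
    inferInstanceAs (DerivedCategory.singleFunctor (Sh A V) 0).Full
  Functor.Full.of_comp_faithful (inDegreeZero A V) DerivedCategory.Plus.ι

/-- The object `A_V` of `D⁺(V)`. -/
abbrev AA (A : Type u) [CommRing A] (V : TopCat.{u}) : DPlus A V :=
  (inDegreeZero A V).obj (constSheaf A V)

/-- The inclusion of a subspace. -/
abbrev incl {V : TopCat.{u}} (S : Set V) : TopCat.of S ⟶ V :=
  TopCat.ofHom ⟨Subtype.val, continuous_subtype_val⟩

/-- The constant sheaf `A_S` on a subspace `S ⊆ V`, seen as a sheaf on `V` by direct image along the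
inclusion; for `S` closed this is the extension by zero of `A_S`. -/
abbrev constSheafOn (A : Type u) [CommRing A] {V : TopCat.{u}} (S : Set V) : Sh A V :=
  (push A (incl S)).obj (constSheaf A (TopCat.of S))

/-- The object `A_S` of `D⁺(V)`, for a (closed) subspace `S ⊆ V`. -/
abbrev AAOn (A : Type u) [CommRing A] {V : TopCat.{u}} (S : Set V) : DPlus A V :=
  (inDegreeZero A V).obj (constSheafOn A S)

section Gysin

variable {A : Type u} [CommRing A] {X Y : TopCat.{u}} (f : X ⟶ Y)

/-- The map of sheaves `f_* A_X ⟶ A_Y` which a bivariant class `θ : Rf_* A_X ⟶ A_Y` induces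
in degree zero: the unique one which gives `f_* A_X ⟶ Rf_* A_X ⟶ A_Y` in the derived category. -/
def degreeZeroPart (θ : (Rpush A f).obj (AA A X) ⟶ AA A Y) :
    (push A f).obj (constSheaf A X) ⟶ constSheaf A Y :=
  (inDegreeZero A Y).preimage (pushToRpush A f (constSheaf A X) ≫ θ)

/-- The Gysin morphism `θ₀ : H⁰(X) ⟶ H⁰(Y)` induced by a bivariant class `θ : Rf_* A_X ⟶ A_Y`,
where `H⁰(X) = Γ(X, A_X) = Γ(Y, f_* A_X)`. -/
def gysin (θ : (Rpush A f).obj (AA A X) ⟶ AA A Y) : H0 A X ⟶ H0 A Y :=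
  (degreeZeroPart f θ).hom.app (op ⊤)

/-- A bivariant class `θ` has degree one if `θ₀(1_X) = 1_Y`. -/
def HasDegreeOne (θ : (Rpush A f).obj (AA A X) ⟶ AA A Y) : Prop :=
  (gysin f θ).hom (oneClass A X) = oneClass A Y

end Gysin

section Constructible

variable {A : Type u} [CommRing A] {V : TopCat.{u}}

/-- The restriction of the sheaf `F` to the subspace `S` is locally constant with
finitely generated stalks. -/
def IsLocallyConstantOn (F : Sh A V) (S : Set V) : Prop :=
  ∀ s ∈ S, ∃ O : Set V, IsOpen O ∧ s ∈ O ∧ ∃ M : ModuleCat.{u} A, Module.Finite A M ∧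
    Nonempty ((pull A (incl (S ∩ O))).obj F ≅ constSheafOf M (TopCat.of (S ∩ O : Set V)))

/-- A sheaf `F` on `V` is constructible if there is a locally finite partition of `V` into locally
closed subspaces on each of which `F` is locally constant with finitely generated stalks. -/
def IsConstructible (F : Sh A V) : Prop :=
  ∃ (ι : Type u) (S : ι → Set V), (⋃ i, S i) = Set.univ ∧ Pairwise (fun i j ↦ Disjoint (S i) (S j)) ∧
    LocallyFinite S ∧ (∀ i, IsLocallyClosed (S i)) ∧ ∀ i, IsLocallyConstantOn F (S i)

/-- The objects of `D^b_c(V)`, the full subcategory of `D⁺(V)` of the complexes with bounded and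
constructible cohomology. As this subcategory is full, morphisms, isomorphisms and direct sum
decompositions of its objects are those of `D⁺(V)`. -/
def Dbc (A : Type u) [CommRing A] (V : TopCat.{u}) : ObjectProperty (DPlus A V) :=
  fun K ↦ (∃ n : ℤ, K.IsLE n) ∧
    ∀ n : ℤ, IsConstructible ((DerivedCategory.Plus.homologyFunctor (Sh A V) n).obj K)

end Constructible

end

end Bivariant

/-!
Let `u : A_Y ⟶ Rf_* A_X` be the canonical morphism, given on sheaves by `1 ↦ 1`. A class `θ` has
degree one exactly when `u ≫ θ = 𝟙`, since both conditions say that the endomorphism of `A_Y`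
induced by `u ≫ θ` fixes the section `1` (`hasDegreeOne_iff`). So a class of degree one is a
splitting of `u`, and the cone of the split monomorphism `u` is the complement `K`
(`exists_biproduct_of_split`).

The restrictions `r : Rf_* A_X ⟶ Rf_* A_{f⁻¹W}` and `c : A_Y ⟶ A_W` and the canonical morphism
`g : A_W ⟶ Rf_* A_{f⁻¹W}` satisfy `u ≫ r = c ≫ g` (`restriction_square`). On the stalks of the
cohomology sheaves, `r` and `c` are isomorphisms at the points of `W`, while at the points of
`U`, over which the fibres are single points, `u` is an isomorphism and `A_W` and `Rf_* A_{f⁻¹W}`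
are zero. In both cases it follows by matrix algebra that the morphism
`Rf_* A_X ⊞ A_W ⟶ Rf_* A_{f⁻¹W} ⊞ A_Y` with components `r`, `g`, `θ` and `0` is an isomorphism on stalks, hence an
isomorphism (`exists_iso_of_hasDegreeOne`).

Conversely, a decomposition of either kind gives a morphism `p : Rf_* A_X ⟶ A_Y` which is
surjective on the degree `0` stalk at some `y ∈ U`. As `Y` is connected, `u ≫ p` is the
multiplication by an element of `A`, which is a unit because it is surjective on the stalk at
`y`; dividing `p` by it gives a class of degree one (`exists_hasDegreeOne`).

The statements on stalks of `Rf_*` replace proper base change. A bounded below complex of flasque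
sheaves with exact stalks along a compact set is exact on sections near that set
(`exactNear_of_isCompact`), by gluing finitely many local primitives, the differences of which
are corrected by induction on the degree and extended by flasqueness. For a closed map the
neighbourhoods of a fibre are refined by preimages, so that the direct image of such a complex
has exact stalks. This is applied to the kernel of a degreewise split epimorphism of injective
resolutions (`isIso_stalkH_Rpush_map`).

For constructibility, `r` and `c` reduce the claim on `A_W` and `Rf_* A_{f⁻¹W}` to the one on
`A_Y` and `Rf_* A_X`: refine the partition by `U` and `W` (`IsConstructible.of_isIso_stalkAt`).
For `K`, a direct summand of a constant sheaf `M` is the image of an idempotent, which is locally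
an idempotent endomorphism of the module `M` because `M` is finitely generated
(`IsConstructible.of_retract`).
-/

namespace Bivariant

noncomputable section

/-! ### Sections and germs -/

section Sections

variable {A : Type u} [CommRing A] {V : TopCat.{u}}

/-- The module `F(O)` of sections. -/
abbrev Sec (F : Sh A V) (O : Opens V) : ModuleCat.{u} A := F.presheaf.obj (op O)

/-- Restriction of sections, as a linear map. -/
def res (F : Sh A V) {O O' : Opens V} (h : O' ≤ O) : Sec F O →ₗ[A] Sec F O' :=
  (F.presheaf.map (homOfLE h).op).hom

/-- The action of a morphism of sheaves on the sections over `O`, as a linear map. -/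
def onSec {F G : Sh A V} (φ : F ⟶ G) (O : Opens V) : Sec F O →ₗ[A] Sec G O :=
  (φ.hom.app (op O)).hom

/-- The stalk at `x`, as a functor on sheaves of modules. -/
abbrev stalkAt (A : Type u) [CommRing A] {V : TopCat.{u}} (x : V) : Sh A V ⥤ ModuleCat.{u} A :=
  TopCat.Sheaf.forget (ModuleCat.{u} A) V ⋙ TopCat.Presheaf.stalkFunctor (ModuleCat.{u} A) x

/-- The germ at `x` of a section, as a linear map. -/
def germAt (F : Sh A V) (O : Opens V) (x : V) (hx : x ∈ O) : Sec F O →ₗ[A] (stalkAt A x).obj F :=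
  (F.presheaf.germ O x hx).hom

@[simp]
lemma res_res (F : Sh A V) {O O' O'' : Opens V} (h : O' ≤ O) (h' : O'' ≤ O') (s : Sec F O) :
    res F h' (res F h s) = res F (h'.trans h) s := by
  simp only [res, ← LinearMap.comp_apply, ← ModuleCat.hom_comp, ← Functor.map_comp]
  rfl

@[simp]
lemma res_self (F : Sh A V) {O : Opens V} (h : O ≤ O) (s : Sec F O) : res F h s = s := by
  simp [res]

lemma onSec_res {F G : Sh A V} (φ : F ⟶ G) {O O' : Opens V} (h : O' ≤ O) (s : Sec F O) :
    onSec φ O' (res F h s) = res G h (onSec φ O s) := by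
  simp only [res, onSec, ← LinearMap.comp_apply, ← ModuleCat.hom_comp]
  exact congrArg (fun k ↦ k.hom s) (φ.hom.naturality (homOfLE h).op)

@[simp]
lemma onSec_comp {F G H : Sh A V} (φ : F ⟶ G) (ψ : G ⟶ H) (O : Opens V) (s : Sec F O) :
    onSec (φ ≫ ψ) O s = onSec ψ O (onSec φ O s) := rfl

@[simp]
lemma onSec_zero {F G : Sh A V} (O : Opens V) (s : Sec F O) : onSec (0 : F ⟶ G) O s = 0 := rfl

@[simp]
lemma onSec_id {F : Sh A V} (O : Opens V) (s : Sec F O) : onSec (𝟙 F) O s = s := rfl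

@[simp]
lemma germAt_res (F : Sh A V) {O O' : Opens V} (h : O' ≤ O) (x : V) (hx : x ∈ O') (s : Sec F O) :
    germAt F O' x hx (res F h s) = germAt F O x (h hx) s := by
  exact congrArg (fun k ↦ k.hom s) (F.presheaf.germ_res (homOfLE h) x hx)

lemma stalkAt_map_germAt {F G : Sh A V} (φ : F ⟶ G) (O : Opens V) (x : V) (hx : x ∈ O)
    (s : Sec F O) :
    ((stalkAt A x).map φ).hom (germAt F O x hx s) = germAt G O x hx (onSec φ O s) :=
  TopCat.Presheaf.stalkFunctor_map_germ_apply O x hx φ.hom s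

lemma exists_germAt_eq (F : Sh A V) (x : V) (t : (stalkAt A x).obj F) :
    ∃ (O : Opens V) (hx : x ∈ O) (s : Sec F O), germAt F O x hx s = t :=
  TopCat.Presheaf.exists_germ_eq F.presheaf t

lemma exists_res_eq_of_germAt_eq (F : Sh A V) {O : Opens V} {x : V} {hx : x ∈ O} {s t : Sec F O}
    (h : germAt F O x hx s = germAt F O x hx t) :
    ∃ (O' : Opens V) (h : O' ≤ O), x ∈ O' ∧ res F h s = res F h t := by
  obtain ⟨O', hO', i, j, h⟩ := F.presheaf.germ_eq x hx hx s t h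
  exact ⟨O', i.le, hO', h⟩

lemma sec_ext (F : Sh A V) {O : Opens V} {s t : Sec F O}
    (h : ∀ x (hx : x ∈ O), germAt F O x hx s = germAt F O x hx t) : s = t :=
  TopCat.Presheaf.section_ext F O s t h

/-- Two sections which agree on the overlap glue. -/
lemma exists_glue (F : Sh A V) {O₁ O₂ : Opens V} (s₁ : Sec F O₁) (s₂ : Sec F O₂)
    (h : res F (inf_le_left : O₁ ⊓ O₂ ≤ O₁) s₁ = res F (inf_le_right : O₁ ⊓ O₂ ≤ O₂) s₂) :
    ∃ s : Sec F (O₁ ⊔ O₂), res F le_sup_left s = s₁ ∧ res F le_sup_right s = s₂ := by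
  obtain ⟨s, hs, -⟩ := TopCat.Sheaf.existsUnique_gluing' F (fun b : Bool ↦ cond b O₁ O₂) (O₁ ⊔ O₂)
    (fun b ↦ homOfLE (by cases b; exacts [le_sup_right, le_sup_left]))
    (sup_le (le_iSup (fun b : Bool ↦ cond b O₁ O₂) true)
      (le_iSup (fun b : Bool ↦ cond b O₁ O₂) false))
    (fun b ↦ match b with | true => s₁ | false => s₂) (by
      rintro (_ | _) (_ | _)
      · rfl
      · have := congrArg (res F ((inf_comm _ _).le : O₂ ⊓ O₁ ≤ O₁ ⊓ O₂)) h
        rw [res_res, res_res] at this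
        exact this.symm
      · exact h
      · rfl)
  exact ⟨s, hs true, hs false⟩

lemma sec_sup_ext (F : Sh A V) {O₁ O₂ : Opens V} {s t : Sec F (O₁ ⊔ O₂)}
    (h₁ : res F (le_sup_left : O₁ ≤ O₁ ⊔ O₂) s = res F le_sup_left t)
    (h₂ : res F (le_sup_right : O₂ ≤ O₁ ⊔ O₂) s = res F le_sup_right t) : s = t := by
  refine sec_ext F fun x hx ↦ ?_
  rcases hx with hx | hx
  · rw [← germAt_res F le_sup_left x hx, h₁, germAt_res]
  · rw [← germAt_res F le_sup_right x hx, h₂, germAt_res]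

end Sections

/-! ### Injective sheaves are flasque -/

section Flasque

variable {A : Type u} [CommRing A] {V : TopCat.{u}}

/-- Sections over `O` are morphisms from the presheaf of modules which is freely generated by the
presheaf of sets represented by `O`. Therefore extending a section amounts to extending a morphism
along a monomorphism. -/
lemma res_surjective_of_injective (I : Sh A V) [Injective I] {O O' : Opens V} (h : O' ≤ O) :
    Function.Surjective (res I h) := by
  intro s
  let P (O : Opens V) : (Opens V)ᵒᵖ ⥤ ModuleCat.{u} A := yoneda.obj O ⋙ ModuleCat.free A
  let ι : P O' ⟶ P O := Functor.whiskerRight (yoneda.map (homOfLE h)) (ModuleCat.free A)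
  have hι (W) : Mono (ι.app W) := by
    rw [ModuleCat.mono_iff_injective]
    exact Finsupp.mapDomain_injective fun (i j : W.unop ⟶ O') _ ↦ Subsingleton.elim i j
  have : Mono ι := NatTrans.mono_of_mono_app ι
  -- an injective sheaf is injective as a presheaf, since sheafification is exact
  have : Injective I.presheaf :=
    have hadj := sheafificationAdjunction (Opens.grothendieckTopology V) (ModuleCat.{u} A)
    @Injective.injective_of_adjoint _ _ _ _ _ _ inferInstance hadj I ‹_›
  let σ : P O' ⟶ I.presheaf :=
    { app W := ModuleCat.freeDesc (TypeCat.ofHom fun i : W.unop ⟶ O' ↦ res I i.le s)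
      naturality W W' j := by
        apply ModuleCat.free_hom_ext
        intro i
        simp only [P, Functor.comp_map, ConcreteCategory.comp_apply]
        erw [ModuleCat.free_map_apply, ModuleCat.freeDesc_apply, ModuleCat.freeDesc_apply]
        exact (res_res I i.le j.unop.le s).symm }
  let τ : P O ⟶ I.presheaf := Injective.factorThru σ ι
  have hτ : ι ≫ τ = σ := Injective.comp_factorThru σ ι
  refine ⟨(τ.app (op O)).hom (ModuleCat.freeMk (𝟙 O)), ?_⟩
  have h₁ := congrArg (fun k ↦ k.hom (ModuleCat.freeMk (𝟙 O))) (τ.naturality (homOfLE h).op)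
  have h₂ := congrArg (fun k ↦ (k.app (op O')).hom (ModuleCat.freeMk (𝟙 O'))) hτ
  refine h₁.symm.trans (Eq.trans ?_ (h₂.trans ?_))
  · change (τ.app (op O')).hom _ = (τ.app (op O')).hom _
    congr 1
    erw [ModuleCat.free_map_apply]
    rw [Functor.whiskerRight_app]
    erw [ModuleCat.free_map_apply]
    rfl
  · change (ModuleCat.freeDesc _) _ = _
    rw [ModuleCat.freeDesc_apply]
    exact res_self I _ s

end Flasque

/-! ### Exactness on sections near a subset -/

section LocalExactness

variable {A : Type u} [CommRing A] {V : TopCat.{u}}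

/-- The section `s` of `G` is in the image of `φ` on a neighbourhood of `C`. -/
def LiftsNear {F G : Sh A V} (φ : F ⟶ G) {O : Opens V} (s : Sec G O) (C : Set V) : Prop :=
  ∃ (O' : Opens V) (h : O' ≤ O), C ⊆ O' ∧ ∃ t : Sec F O', onSec φ O' t = res G h s

/-- The sequence `F ⟶ G ⟶ H` is exact on sections near `C`: a section of `G` on a neighbourhood of
`C` which is killed by `ψ` comes from a section of `F` on a smaller neighbourhood. -/
def ExactNear {F G H : Sh A V} (φ : F ⟶ G) (ψ : G ⟶ H) (C : Set V) : Prop :=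
  ∀ (O : Opens V), C ⊆ O → ∀ s : Sec G O, onSec ψ O s = 0 → LiftsNear φ s C

lemma LiftsNear.mono {F G : Sh A V} {φ : F ⟶ G} {O : Opens V} {s : Sec G O} {C C' : Set V}
    (h : LiftsNear φ s C) (hC : C' ⊆ C) : LiftsNear φ s C' := by
  obtain ⟨O', h, hO', t⟩ := h
  exact ⟨O', h, hC.trans hO', t⟩

/-- A section of `G` which lifts to `F` near two compact subsets lifts to `F` near their union, when
the two lifts differ near the intersection by something which comes from a flasque sheaf `F₀`. -/
lemma LiftsNear.union [T2Space V] {F₀ F G : Sh A V} {δ : F₀ ⟶ F} {φ : F ⟶ G} (w : δ ≫ φ = 0)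
    (hF₀ : ∀ O : Opens V, Function.Surjective (res F₀ (le_top : O ≤ ⊤)))
    {C₁ C₂ : Set V} (hC₁ : IsCompact C₁) (hC₂ : IsCompact C₂) (hex : ExactNear δ φ (C₁ ∩ C₂))
    {O : Opens V} {s : Sec G O} (h₁ : LiftsNear φ s C₁) (h₂ : LiftsNear φ s C₂) :
    LiftsNear φ s (C₁ ∪ C₂) := by
  obtain ⟨O₁, hO₁, hCO₁, t₁, ht₁⟩ := h₁
  obtain ⟨O₂, hO₂, hCO₂, t₂, ht₂⟩ := h₂
  -- on the overlap, the difference of the two lifts is killed by `φ`, hence comes from `F₀`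
  obtain ⟨N, hN, hCN, v, hv⟩ := hex (O₁ ⊓ O₂) (Set.inter_subset_inter hCO₁ hCO₂)
    (res F inf_le_left t₁ - res F inf_le_right t₂)
    (by simp only [map_sub, onSec_res, ht₁, ht₂, res_res, sub_self])
  obtain ⟨v, rfl⟩ := hF₀ N v
  -- shrink the two neighbourhoods so that they only meet inside `N`
  obtain ⟨B₁, B₂, hB₁, hB₂, hCB₁, hCB₂, hB⟩ :=
    SeparatedNhds.of_isCompact_isCompact (hC₁.diff N.isOpen) hC₂
      (Set.disjoint_left.2 fun x hx hx' ↦ hx.2 (hCN ⟨hx.1, hx'⟩))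
  let O₁' : Opens V := O₁ ⊓ (⟨B₁, hB₁⟩ ⊔ N)
  let O₂' : Opens V := O₂ ⊓ ⟨B₂, hB₂⟩
  have h₁ : O₁' ≤ O₁ := inf_le_left
  have h₂ : O₂' ≤ O₂ := inf_le_left
  have hCO₁' : C₁ ⊆ O₁' := fun x hx ↦ ⟨hCO₁ hx, by
    by_cases hxN : x ∈ N
    · exact Or.inr hxN
    · exact Or.inl (hCB₁ ⟨hx, hxN⟩)⟩
  have hCO₂' : C₂ ⊆ O₂' := fun x hx ↦ ⟨hCO₂ hx, hCB₂ hx⟩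
  have hN' : O₁' ⊓ O₂' ≤ N := by
    rintro x ⟨⟨-, hx | hx⟩, -, hx'⟩
    · exact (Set.disjoint_left.1 hB hx hx').elim
    · exact hx
  -- the correction by the extension of `v` makes the two lifts agree on the overlap
  obtain ⟨t, ht, ht'⟩ := exists_glue F (res F h₁ t₁)
    (res F h₂ (t₂ + res F le_top (onSec δ ⊤ v))) (by
      have hv' := congrArg (res F hN') hv
      simp only [onSec_res, res_res, map_sub] at hv'
      simp only [map_add, res_res, hv']
      abel)
  refine ⟨O₁' ⊔ O₂', sup_le (h₁.trans hO₁) (h₂.trans hO₂),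
    Set.union_subset_union hCO₁' hCO₂', t, sec_sup_ext G ?_ ?_⟩
  · rw [← onSec_res, ht, onSec_res, ht₁, res_res, res_res]
  · rw [← onSec_res, ht', onSec_res, map_add, ht₂, onSec_res, ← onSec_comp, w, onSec_zero, map_zero,
      add_zero, res_res, res_res]

lemma sec_eq_zero_of_isZero {F : Sh A V} (hF : IsZero F) {O : Opens V} (s : Sec F O) : s = 0 := by
  rw [← onSec_id O s, hF.eq_of_src (𝟙 F) 0, onSec_zero]

/-- A bounded below complex of flasque sheaves which is exact near every point of a compact subset
is exact near that subset. -/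
lemma exactNear_of_isCompact [T3Space V] (K : CochainComplex (Sh A V) ℤ) (m : ℤ)
    [K.IsStrictlyGE m] (hK : ∀ n (O : Opens V), Function.Surjective (res (K.X n) (le_top : O ≤ ⊤)))
    (Z : Set V) (hZ : ∀ x ∈ Z, ∀ i j k : ℤ, i + 1 = j → j + 1 = k →
      ExactNear (K.d i j) (K.d j k) {x})
    (i j k : ℤ) (hij : i + 1 = j) (hjk : j + 1 = k) (C : Set V) (hC : IsCompact C) (hCZ : C ⊆ Z) :
    ExactNear (K.d i j) (K.d j k) C := by
  obtain ⟨n, hn⟩ : ∃ n : ℕ, j < m + n := ⟨(j - m + 1).toNat, by lia⟩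
  induction n generalizing i j k C with
  | zero =>
    intro O hO s _
    refine ⟨O, le_rfl, hO, 0, ?_⟩
    rw [sec_eq_zero_of_isZero (K.isZero_of_isStrictlyGE m j (by lia)) s]
    simp
  | succ n ih =>
    intro O hO s hs
    -- `IsCompact.induction_on` runs over arbitrary subsets; each is enlarged to a compact one, as
    -- gluing needs compact pieces
    suffices ∃ C' : Set V, C ⊆ C' ∧ IsCompact C' ∧ C' ⊆ C ∧ LiftsNear (K.d i j) s C' by
      obtain ⟨C', hC', -, -, h⟩ := this
      exact h.mono hC'
    refine hC.induction_on
      (p := fun T ↦ ∃ C' : Set V, T ⊆ C' ∧ IsCompact C' ∧ C' ⊆ C ∧ LiftsNear (K.d i j) s C')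
      ?_ ?_ ?_ ?_
    · exact ⟨∅, subset_rfl, isCompact_empty, Set.empty_subset _, ⊥, bot_le, Set.empty_subset _, 0,
        sec_ext _ fun x hx ↦ hx.elim⟩
    · rintro T T' hT ⟨C', h⟩
      exact ⟨C', hT.trans h.1, h.2⟩
    · rintro T T' ⟨C₁, hT₁, hC₁, hCC₁, h₁⟩ ⟨C₂, hT₂, hC₂, hCC₂, h₂⟩
      exact ⟨C₁ ∪ C₂, Set.union_subset_union hT₁ hT₂, hC₁.union hC₂, Set.union_subset hCC₁ hCC₂,
        h₁.union (K.d_comp_d (i - 1) i j) (hK _) hC₁ hC₂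
          (ih (i - 1) i j (by lia) hij _ (hC₁.inter hC₂)
            (Set.inter_subset_left.trans (hCC₁.trans hCZ)) (by lia)) h₂⟩
    · intro x hx
      obtain ⟨O', hO', hxO', h⟩ := hZ x (hCZ hx) i j k hij hjk O (by simpa using hO hx) s hs
      obtain ⟨T, hT, hTc, hTO'⟩ :=
        exists_mem_nhds_isClosed_subset (O'.isOpen.mem_nhds (hxO' (Set.mem_singleton x)))
      exact ⟨C ∩ T, inter_mem_nhdsWithin C hT, C ∩ T, subset_rfl, hC.inter_right hTc,
        Set.inter_subset_left, O', hO', Set.inter_subset_right.trans hTO', h⟩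

/-- Exactness near a point is exactness on the stalks at this point. -/
lemma exactNear_singleton_iff {F G H : Sh A V} (φ : F ⟶ G) (ψ : G ⟶ H) (w : φ ≫ ψ = 0) (x : V) :
    ExactNear φ ψ {x} ↔ ((ShortComplex.mk φ ψ w).map (stalkAt A x)).Exact := by
  rw [ShortComplex.moduleCat_exact_iff]
  constructor
  · intro h t ht
    obtain ⟨O, hx, s, rfl⟩ := exists_germAt_eq G x t
    have ht' : germAt H O x hx (onSec ψ O s) = germAt H O x hx 0 := by
      rw [map_zero, ← stalkAt_map_germAt]
      exact ht
    obtain ⟨O', hO', hx', hs⟩ := exists_res_eq_of_germAt_eq H ht'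
    rw [map_zero, ← onSec_res] at hs
    obtain ⟨O'', hO'', hx'', r, hr⟩ := h O' (by simpa using hx') _ hs
    refine ⟨germAt F O'' x (hx'' rfl) r, (stalkAt_map_germAt φ O'' x (hx'' rfl) r).trans ?_⟩
    rw [hr, germAt_res, germAt_res]
  · intro h O hx s hs
    replace hx : x ∈ O := hx rfl
    obtain ⟨r, hr⟩ := h (germAt G O x hx s) (by
      exact (stalkAt_map_germAt ψ O x hx s).trans ((congrArg _ hs).trans (map_zero _)))
    obtain ⟨O', hx', r, rfl⟩ := exists_germAt_eq F x r
    have hxO : x ∈ O ⊓ O' := ⟨hx, hx'⟩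
    have hr' : germAt G (O ⊓ O') x hxO (onSec φ _ (res F inf_le_right r)) =
        germAt G (O ⊓ O') x hxO (res G inf_le_left s) := by
      rw [← stalkAt_map_germAt, germAt_res, germAt_res]
      exact hr
    obtain ⟨O'', hO'', hx'', h⟩ := exists_res_eq_of_germAt_eq G hr'
    exact ⟨O'', hO''.trans inf_le_left, by simpa using hx'', res F (hO''.trans inf_le_right) r, by
      simpa [onSec_res] using h⟩

lemma exactNear_singleton_iff_isZero (K : CochainComplex (Sh A V) ℤ) (i j k : ℤ) (hij : i + 1 = j)
    (hjk : j + 1 = k) (x : V) :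
    ExactNear (K.d i j) (K.d j k) {x} ↔ IsZero ((stalkAt A x).obj (K.homology j)) := by
  rw [exactNear_singleton_iff _ _ (K.d_comp_d i j k), ShortComplex.exact_iff_isZero_homology]
  refine (((K.sc' i j k).mapHomologyIso (stalkAt A x)) ≪≫ (stalkAt A x).mapIso
    (K.homologyIsoSc' i j k ?_ ?_).symm).isZero_iff
  · simp only [CochainComplex.prev]; lia
  · simp only [CochainComplex.next]; lia

end LocalExactness

/-! ### Direct images under closed maps -/

section ClosedMaps

variable {A : Type u} [CommRing A] {V Z : TopCat.{u}} {f : V ⟶ Z}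

/-- For a closed map, the open neighbourhoods of a fibre are refined by preimages. -/
lemma exists_map_le_of_isClosedMap (hf : IsClosedMap f) {z : Z} {O : Opens V}
    (hO : f ⁻¹' {z} ⊆ O) : ∃ O' : Opens Z, z ∈ O' ∧ (Opens.map f).obj O' ≤ O := by
  refine ⟨⟨(f '' (O : Set V)ᶜ)ᶜ, (hf _ O.isOpen.isClosed_compl).isOpen_compl⟩, ?_, ?_⟩
  · rintro ⟨x, hx, rfl⟩
    exact hx (hO rfl)
  · intro x hx
    by_contra hxO
    exact hx ⟨x, hxO, rfl⟩

/-- The direct image under a closed map of a sequence which is exact near a fibre is exact near the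
image point. -/
lemma ExactNear.push (hf : IsClosedMap f) {F G H : Sh A V} {φ : F ⟶ G} {ψ : G ⟶ H} {z : Z}
    (h : ExactNear φ ψ (f ⁻¹' {z})) :
    ExactNear ((push A f).map φ) ((push A f).map ψ) {z} := by
  intro O hO s hs
  have hO' : f ⁻¹' {z} ⊆ (Opens.map f).obj O := by
    rintro x rfl
    exact hO rfl
  obtain ⟨N, hN, hfN, t, ht⟩ := h ((Opens.map f).obj O) hO' s hs
  obtain ⟨O', hz, hO'N⟩ := exists_map_le_of_isClosedMap hf hfN
  have hle : (Opens.map f).obj (O' ⊓ O) ≤ N := ((Opens.map f).monotone inf_le_left).trans hO'N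
  refine ⟨O' ⊓ O, inf_le_right, by simpa using ⟨hz, hO rfl⟩, res F hle t, ?_⟩
  refine (onSec_res φ hle t).trans ?_
  rw [ht]
  exact res_res G hN hle s

lemma isZero_stalkAt_push_of_isEmpty (hf : IsClosedMap f) (F : Sh A V) {z : Z}
    (hz : f ⁻¹' {z} = ∅) : IsZero ((stalkAt A z).obj ((push A f).obj F)) := by
  rw [ModuleCat.isZero_iff_subsingleton]
  refine subsingleton_of_forall_eq 0 fun t ↦ ?_
  obtain ⟨O, hx, s, rfl⟩ := exists_germAt_eq _ z t
  obtain ⟨O', hz', hO'⟩ := exists_map_le_of_isClosedMap hf (z := z) (O := ⊥) (by simp [hz])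
  rw [← germAt_res _ (inf_le_left : O ⊓ O' ≤ O) z ⟨hx, hz'⟩]
  convert map_zero (germAt ((Bivariant.push A f).obj F) (O ⊓ O') z ⟨hx, hz'⟩)
  exact sec_ext F fun x hx ↦ (hO' hx.2).elim

end ClosedMaps

/-! ### Constant sheaves -/

section ConstantSheaves

variable {A : Type u} [CommRing A] {V : TopCat.{u}}

/-- The global section of the constant sheaf given by an element of `M`. -/
def constSec (M : ModuleCat.{u} A) (V : TopCat.{u}) : M →ₗ[A] Sec (constSheafOf M V) ⊤ :=
  ((constantSheafAdj (Opens.grothendieckTopology V) (ModuleCat.{u} A)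
    (isTerminalTop : IsTerminal (⊤ : Opens V))).unit.app M).hom

lemma constSec_one : constSec (ModuleCat.of A A) V (1 : A) = oneClass A V := rfl

lemma constSec_eq_smul (a : A) : constSec (ModuleCat.of A A) V a = a • oneClass A V := by
  rw [← constSec_one, ← map_smul]
  congr 1
  exact (mul_one a).symm

/-- The constant sheaf on `M` has stalks `M`. -/
lemma germAt_constSec_bijective (M : ModuleCat.{u} A) (x : V) :
    Function.Bijective fun m : M ↦ germAt (constSheafOf M V) ⊤ x trivial (constSec M V m) := by
  let P : TopCat.Presheaf (ModuleCat.{u} A) V := (Functor.const _).obj M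
  let η := CategoryTheory.toSheafify (Opens.grothendieckTopology V) P
  have hη : IsIso ((TopCat.Presheaf.stalkFunctor (ModuleCat.{u} A) x).map η) :=
    TopCat.Presheaf.stalkFunctor_map_unit_toSheafify_isIso x _ P
  have h₁ : Function.Bijective (((TopCat.Presheaf.stalkFunctor (ModuleCat.{u} A) x).map η).hom) :=
    (ConcreteCategory.isIso_iff_bijective _).1 hη
  have h₂ : Function.Bijective (P.germ ⊤ x trivial).hom := by
    refine ⟨fun m m' h ↦ ?_, fun t ↦ ?_⟩
    · obtain ⟨_, _, _, _, h⟩ := P.germ_eq x (Opens.mem_top x) (Opens.mem_top x) m m' h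
      exact h
    · obtain ⟨O, hO, m, rfl⟩ := P.exists_germ_eq t
      exact ⟨m, (P.germ_res_apply (homOfLE le_top : O ⟶ ⊤) x hO m).symm⟩
  refine Eq.mp (congrArg Function.Bijective (funext fun m ↦ ?_)) (h₁.comp h₂)
  exact TopCat.Presheaf.stalkFunctor_map_germ_apply ⊤ x trivial η m

/-- Morphisms out of a constant sheaf are determined by their values on the constant sections. -/
lemma constSheafOf_hom_ext {M : ModuleCat.{u} A} {F : Sh A V} {φ ψ : constSheafOf M V ⟶ F}
    (h : ∀ m, onSec φ ⊤ (constSec M V m) = onSec ψ ⊤ (constSec M V m)) : φ = ψ := by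
  apply ((constantSheafAdj (Opens.grothendieckTopology V) (ModuleCat.{u} A)
    (isTerminalTop : IsTerminal (⊤ : Opens V))).homEquiv M F).injective
  ext m
  exact h m

lemma constSheaf_hom_ext {F : Sh A V} {φ ψ : constSheaf A V ⟶ F}
    (h : onSec φ ⊤ (oneClass A V) = onSec ψ ⊤ (oneClass A V)) : φ = ψ := by
  refine constSheafOf_hom_ext fun (a : A) ↦ ?_
  rw [constSec_eq_smul, map_smul, map_smul, h]

/-- The morphism `M_V ⟶ F` with prescribed values on the constant sections. -/
def constSheafOfDesc {M : ModuleCat.{u} A} {F : Sh A V} (k : M →ₗ[A] Sec F ⊤) :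
    constSheafOf M V ⟶ F :=
  ((constantSheafAdj (Opens.grothendieckTopology V) (ModuleCat.{u} A)
    (isTerminalTop : IsTerminal (⊤ : Opens V))).homEquiv M F).symm (ModuleCat.ofHom k)

@[simp]
lemma onSec_constSheafOfDesc {M : ModuleCat.{u} A} {F : Sh A V} (k : M →ₗ[A] Sec F ⊤) (m : M) :
    onSec (constSheafOfDesc k) ⊤ (constSec M V m) = k m := by
  let adj := constantSheafAdj (Opens.grothendieckTopology V) (ModuleCat.{u} A)
    (isTerminalTop : IsTerminal (⊤ : Opens V))
  exact congrArg (fun k ↦ k.hom m) ((adj.homEquiv_unit (f := constSheafOfDesc k)).symm.trans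
    ((adj.homEquiv M F).apply_symm_apply (ModuleCat.ofHom k)))

/-- The morphism `A_V ⟶ F` which sends `1` to a given global section. -/
def ofSec {F : Sh A V} (s : Sec F ⊤) : constSheaf A V ⟶ F :=
  constSheafOfDesc (LinearMap.toSpanSingleton A (Sec F ⊤) s)

@[simp]
lemma onSec_ofSec {F : Sh A V} (s : Sec F ⊤) : onSec (ofSec s) ⊤ (oneClass A V) = s := by
  rw [← constSec_one]
  refine (onSec_constSheafOfDesc _ _).trans ?_
  simp

/-- The generator of the stalk of `A_V` at `x`. -/
abbrev germOne (A : Type u) [CommRing A] {V : TopCat.{u}} (x : V) :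
    (stalkAt A x).obj (constSheaf A V) :=
  germAt (constSheaf A V) ⊤ x trivial (oneClass A V)

lemma smul_germOne_bijective (x : V) :
    Function.Bijective fun a : A ↦ a • germOne A x := by
  convert germAt_constSec_bijective (ModuleCat.of A A) x using 1
  funext a
  rw [constSec_eq_smul, map_smul]

/-- On a connected space, the global sections of the constant sheaf are constant. -/
lemma exists_eq_smul_oneClass [PreconnectedSpace V] [Nonempty V] (s : H0 A V) :
    ∃ a : A, s = a • oneClass A V := by
  choose a ha using fun x ↦ (smul_germOne_bijective (A := A) x).2
    (germAt (constSheaf A V) ⊤ x trivial s)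
  have hloc : IsLocallyConstant a := by
    rw [IsLocallyConstant.iff_exists_open]
    intro x
    obtain ⟨O, h, hx, hO⟩ := exists_res_eq_of_germAt_eq (constSheaf A V) (hx := Opens.mem_top x)
      (s := a x • oneClass A V) (t := s) ((map_smul _ _ _).trans (ha x))
    refine ⟨O, O.isOpen, hx, fun y hy ↦ (smul_germOne_bijective (A := A) y).1 ?_⟩
    have := congrArg (germAt (constSheaf A V) O y hy) hO
    rw [germAt_res, germAt_res, map_smul] at this
    exact (ha y).trans this.symm
  obtain ⟨x₀⟩ := ‹Nonempty V›
  refine ⟨a x₀, sec_ext _ fun x hx ↦ ?_⟩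
  rw [map_smul, ← hloc.apply_eq_of_preconnectedSpace x x₀]
  exact (ha x).symm

end ConstantSheaves

/-! ### The morphism `A_Z ⟶ g_* A_V` -/

section PullbackOfOne

variable {A : Type u} [CommRing A] {V Z : TopCat.{u}}

/-- The canonical morphism `A_Z ⟶ g_* A_V`, which sends `1` to `1`. -/
def constToPush (A : Type u) [CommRing A] (g : V ⟶ Z) :
    constSheaf A Z ⟶ (push A g).obj (constSheaf A V) :=
  ofSec (F := (push A g).obj (constSheaf A V)) (oneClass A V)

@[simp]
lemma onSec_constToPush (g : V ⟶ Z) :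
    onSec (constToPush A g) ⊤ (oneClass A Z) = oneClass A V :=
  onSec_ofSec (F := (push A g).obj (constSheaf A V)) (oneClass A V)

/-- The canonical map from the stalk of `g_* F` at `g x` to the stalk of `F` at `x`. -/
def stalkPush (g : V ⟶ Z) (F : Sh A V) (x : V) :
    (stalkAt A (g x)).obj ((push A g).obj F) →ₗ[A] (stalkAt A x).obj F :=
  (F.presheaf.stalkPushforward (ModuleCat.{u} A) g x).hom

lemma stalkPush_germAt (g : V ⟶ Z) (F : Sh A V) (x : V) (O : Opens Z) (hO : g x ∈ O)
    (s : Sec ((push A g).obj F) O) :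
    stalkPush g F x (germAt _ O (g x) hO s) = germAt F ((Opens.map g).obj O) x hO s :=
  congrArg (fun k ↦ k.hom s) (F.presheaf.stalkPushforward_germ (ModuleCat.{u} A) g O x hO)

/-- If the fibre of a closed map `g` at `z` is a single point, then `A_Z ⟶ g_* A_V` is an
isomorphism on the stalks at `z`. -/
lemma isIso_stalkAt_constToPush {g : V ⟶ Z} (hg : IsClosedMap g) {x : V} {z : Z}
    (hx : g ⁻¹' {z} = {x}) : IsIso ((stalkAt A z).map (constToPush A g)) := by
  rw [ConcreteCategory.isIso_iff_bijective]
  have hgx : g x = z := by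
    have : x ∈ g ⁻¹' {z} := by rw [hx]; rfl
    exact this
  subst hgx
  -- a section over the preimage of `O` with zero germ at the only point of the fibre vanishes on
  -- the preimage of a smaller neighbourhood
  have hσ : Function.Injective (stalkPush g (constSheaf A V) x) := by
    rw [injective_iff_map_eq_zero]
    intro t ht
    obtain ⟨O, hO, s, rfl⟩ := exists_germAt_eq _ (g x) t
    rw [stalkPush_germAt] at ht
    obtain ⟨N, hN, hxN, hs⟩ := exists_res_eq_of_germAt_eq (constSheaf A V)
      (ht.trans (map_zero _).symm)
    obtain ⟨O', hO', hO'N⟩ := exists_map_le_of_isClosedMap hg (z := g x) (O := N)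
      (by rw [hx]; simpa using hxN)
    have hle : O ⊓ O' ≤ O := inf_le_left
    have hle' : (Opens.map g).obj (O ⊓ O') ≤ N :=
      ((Opens.map g).monotone (inf_le_right : O ⊓ O' ≤ O')).trans hO'N
    have h0 : res ((push A g).obj (constSheaf A V)) hle s = 0 := by
      have := congrArg (res (constSheaf A V) hle') hs
      rw [map_zero, map_zero] at this
      exact (res_res (constSheaf A V) hN hle' s).symm.trans this
    rw [← germAt_res _ hle (g x) ⟨hO, hO'⟩, h0, map_zero]
  -- both stalks are free on the germ of `1`, which is preserved
  have hcomp : Function.Bijective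
      (stalkPush g (constSheaf A V) x ∘ ((stalkAt A (g x)).map (constToPush A g)).hom) := by
    have key (a : A) :
        (stalkPush g (constSheaf A V) x ∘ ((stalkAt A (g x)).map (constToPush A g)).hom)
          (a • germOne A (g x)) = a • germOne A x := by
      rw [Function.comp_apply, map_smul, map_smul]
      congr 1
      refine (congrArg _ (stalkAt_map_germAt (constToPush A g) ⊤ (g x) trivial _)).trans ?_
      rw [onSec_constToPush]
      exact stalkPush_germAt g _ x ⊤ trivial _
    have h₁ := smul_germOne_bijective (A := A) (g x)
    have h₂ := smul_germOne_bijective (A := A) x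
    rw [← Function.Bijective.of_comp_iff _ h₁]
    exact Eq.mp (congrArg Function.Bijective (funext fun a ↦ (key a).symm)) h₂
  exact ⟨hcomp.1.of_comp, fun t ↦ by
    obtain ⟨r, hr⟩ := hcomp.2 (stalkPush g (constSheaf A V) x t)
    exact ⟨r, hσ hr⟩⟩

end PullbackOfOne

/-! ### Derived functors and resolutions -/

section DerivedFunctors

variable {C D : Type*} [Category* C] [Category* D] [Abelian C] [Abelian D]
  [HasDerivedCategory C] [HasDerivedCategory D] (F : C ⥤ D) [F.Additive]

/-- An object, as a bounded below complex concentrated in degree `0`. -/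
def singlePlus (X : C) : CochainComplex.Plus C :=
  ⟨(HomologicalComplex.single C (ComplexShape.up ℤ) 0).obj X, ⟨0, inferInstance⟩⟩

/-- A morphism, as a morphism of bounded below complexes concentrated in degree `0`. -/
def singlePlusMap {X X' : C} (φ : X ⟶ X') : singlePlus X ⟶ singlePlus X' :=
  ObjectProperty.homMk ((HomologicalComplex.single C (ComplexShape.up ℤ) 0).map φ)

lemma isIso_Q_map {K L : CochainComplex.Plus C} (α : K ⟶ L) (hα : QuasiIso α.hom) :
    IsIso (DerivedCategory.Plus.Q.map α) := by
  have : IsIso (DerivedCategory.Plus.ι.map (DerivedCategory.Plus.Q.map α)) :=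
    inferInstanceAs (IsIso (DerivedCategory.Q.map α.hom))
  exact isIso_of_fully_faithful DerivedCategory.Plus.ι _

variable [EnoughInjectives C]

/-- The canonical morphism `F(I) ⟶ RF(I)`, for a bounded below complex `I`. -/
def toDerived (I : CochainComplex.Plus C) :
    DerivedCategory.Plus.Q.obj (F.mapCochainComplexPlus.obj I) ⟶
      F.rightDerivedFunctorPlus.obj (DerivedCategory.Plus.Q.obj I) :=
  F.rightDerivedFunctorPlusUnit.app ((HomotopyCategory.Plus.quotient C).obj I)

lemma toDerived_naturality {I J : CochainComplex.Plus C} (π : I ⟶ J) :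
    DerivedCategory.Plus.Q.map (F.mapCochainComplexPlus.map π) ≫ toDerived F J =
      toDerived F I ≫ F.rightDerivedFunctorPlus.map (DerivedCategory.Plus.Q.map π) :=
  F.rightDerivedFunctorPlusUnit.naturality ((HomotopyCategory.Plus.quotient C).map π)

lemma isIso_toDerived (I : CochainComplex.Plus C) (hI : ∀ n, Injective (I.obj.X n)) :
    IsIso (toDerived F I) :=
  have (n : ℤ) : Injective (((HomotopyCategory.Plus.quotient C).obj I).obj.as.X n) := hI n
  inferInstanceAs (IsIso
    (F.rightDerivedFunctorPlusUnit.app ((HomotopyCategory.Plus.quotient C).obj I)))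

/-- The derived functor of `F` is computed by applying `F` to an injective resolution. -/
def resolutionIso {K I : CochainComplex.Plus C} (hI : ∀ n, Injective (I.obj.X n))
    (α : K ⟶ I) (hα : QuasiIso α.hom) :
    F.rightDerivedFunctorPlus.obj (DerivedCategory.Plus.Q.obj K) ≅
      DerivedCategory.Plus.Q.obj (F.mapCochainComplexPlus.obj I) :=
  have := isIso_Q_map α hα
  have := isIso_toDerived F I hI
  F.rightDerivedFunctorPlus.mapIso (asIso (DerivedCategory.Plus.Q.map α)) ≪≫
    (asIso (toDerived F I)).symm

lemma resolutionIso_hom_toDerived {K I : CochainComplex.Plus C} (hI : ∀ n, Injective (I.obj.X n))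
    (α : K ⟶ I) (hα : QuasiIso α.hom) :
    (resolutionIso F hI α hα).hom ≫ toDerived F I =
      F.rightDerivedFunctorPlus.map (DerivedCategory.Plus.Q.map α) := by
  simp [resolutionIso]

lemma toDerived_resolutionIso_hom {K I : CochainComplex.Plus C} (hI : ∀ n, Injective (I.obj.X n))
    (α : K ⟶ I) (hα : QuasiIso α.hom) :
    toDerived F K ≫ (resolutionIso F hI α hα).hom =
      DerivedCategory.Plus.Q.map (F.mapCochainComplexPlus.map α) := by
  have := isIso_toDerived F I hI
  rw [← cancel_mono (toDerived F I), Category.assoc, resolutionIso_hom_toDerived,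
    toDerived_naturality]

lemma resolutionIso_naturality {K L I J : CochainComplex.Plus C} (φ : K ⟶ L)
    (hI : ∀ n, Injective (I.obj.X n)) (hJ : ∀ n, Injective (J.obj.X n))
    (α : K ⟶ I) (hα : QuasiIso α.hom) (β : L ⟶ J) (hβ : QuasiIso β.hom)
    (π : I ⟶ J) (comm : α ≫ π = φ ≫ β) :
    F.rightDerivedFunctorPlus.map (DerivedCategory.Plus.Q.map φ) ≫ (resolutionIso F hJ β hβ).hom =
    (resolutionIso F hI α hα).hom ≫ DerivedCategory.Plus.Q.map (F.mapCochainComplexPlus.map π) := by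
  have := isIso_toDerived F J hJ
  rw [← cancel_mono (toDerived F J), Category.assoc, resolutionIso_hom_toDerived, Category.assoc,
    toDerived_naturality, ← Category.assoc (resolutionIso F hI α hα).hom,
    resolutionIso_hom_toDerived,
    ← Functor.map_comp, ← Functor.map_comp, ← Functor.map_comp, ← Functor.map_comp, comm]

end DerivedFunctors

section Resolutions

variable {C D : Type*} [Category* C] [Category* D] [Abelian C] [Abelian D]

/-- Left exact functors preserve the degree `0` part of a resolution. -/
lemma quasiIsoAt_zero_map_of_quasiIsoAt (F : C ⥤ D) [F.Additive]
    [PreservesFiniteLimits F] {X : C} {I : CochainComplex C ℤ} [I.IsStrictlyGE 0]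
    (α : (HomologicalComplex.single C (ComplexShape.up ℤ) 0).obj X ⟶ I)
    (hα : QuasiIsoAt α 0) :
    QuasiIsoAt ((F.mapHomologicalComplex (ComplexShape.up ℤ)).map α) 0 := by
  have hI : I.d (-1) 0 = 0 := (I.isZero_of_isStrictlyGE 0 (-1)).eq_of_src _ _
  have hX (i j : ℤ) : ((HomologicalComplex.single C (ComplexShape.up ℤ) 0).obj X).d i j = 0 :=
    HomologicalComplex.single_obj_d ..
  rw [quasiIsoAt_iff' _ (-1) 0 1 (by simp) (by simp),
    ShortComplex.quasiIso_iff_of_zeros _ (by exact hX _ _) (by exact hX _ _) (by exact hI)] at hα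
  rw [quasiIsoAt_iff' _ (-1) 0 1 (by simp) (by simp), ShortComplex.quasiIso_iff_of_zeros _
    (by exact (congrArg F.map (hX _ _)).trans (F.map_zero _ _))
    (by exact (congrArg F.map (hX _ _)).trans (F.map_zero _ _))
    (by exact (congrArg F.map hI).trans (F.map_zero _ _))]
  -- both conditions say that `X` is the kernel of the first differential
  rw [ShortComplex.exact_and_mono_f_iff_f_is_kernel] at hα ⊢
  obtain ⟨h⟩ := hα
  exact ⟨KernelFork.mapIsLimit _ h F⟩

variable [EnoughInjectives C]

lemma exists_injective_resolution (X : C) :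
    ∃ (I : CochainComplex.Plus C) (α : singlePlus X ⟶ I), (∀ n, Injective (I.obj.X n)) ∧
      I.obj.IsStrictlyGE 0 ∧ QuasiIso α.hom := by
  have : (singlePlus X).obj.IsStrictlyGE 0 :=
    inferInstanceAs (CochainComplex.IsStrictlyGE
      ((HomologicalComplex.single C (ComplexShape.up ℤ) 0).obj X) 0)
  obtain ⟨I, α, hα, hI, hI'⟩ :=
    CochainComplex.Plus.modelCategoryQuillen.exists_quasiIso_injective (singlePlus X).obj 0
  exact ⟨⟨I, 0, hI'⟩, ObjectProperty.homMk α, hI, hI', hα⟩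

/-- A morphism lifts to a degreewise split epimorphism between injective resolutions, the kernel of
which consists of injective objects. -/
lemma exists_injective_resolution_map {X X' : C} (φ : X ⟶ X') :
    ∃ (I J : CochainComplex.Plus C) (α : singlePlus X ⟶ I) (β : singlePlus X' ⟶ J) (π : I ⟶ J),
      (∀ n, Injective (I.obj.X n)) ∧ (∀ n, Injective (J.obj.X n)) ∧ QuasiIso α.hom ∧
      QuasiIso β.hom ∧ CochainComplex.degreewiseEpiWithInjectiveKernel π.hom ∧
      α ≫ π = singlePlusMap φ ≫ β := by
  obtain ⟨J, β, hJ, hJ', hβ⟩ := exists_injective_resolution X'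
  have : (singlePlus X).obj.IsStrictlyGE ((-1 : ℤ) + 1) :=
    inferInstanceAs (CochainComplex.IsStrictlyGE
      ((HomologicalComplex.single C (ComplexShape.up ℤ) 0).obj X) 0)
  have : J.obj.IsStrictlyGE (-1) := J.obj.isStrictlyGE_of_ge (-1) 0 (by lia)
  obtain ⟨I, hI, α, π, -, hα, hπ, h⟩ :=
    CochainComplex.Plus.modelCategoryQuillen.cm5a (singlePlusMap φ ≫ β).hom (-1)
  refine ⟨⟨I, -1, hI⟩, J, ObjectProperty.homMk α, β, ObjectProperty.homMk π, fun n ↦ ?_, hJ, hα, hβ,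
    hπ, by ext : 1; exact h⟩
  obtain ⟨L, hL, i, w, ⟨s⟩⟩ := (Abelian.epiWithInjectiveKernel_iff _).1 (hπ n)
  have := hJ n
  exact Injective.of_iso s.isoBinaryBiproduct.symm inferInstance

end Resolutions

/-! ### Long exact sequences -/

section LongExactSequence

variable {C E : Type*} [Category* C] [Category* E] [Abelian C] [Abelian E] (Ψ : C ⥤ E)
  [Ψ.Additive] [Ψ.PreservesHomology] {S : ShortComplex (CochainComplex C ℤ)}

/-- If `S.g` becomes a quasi-isomorphism after applying an exact functor `Ψ` to the cohomology, then
the cohomology of `S.X₁` vanishes after applying `Ψ`. -/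
lemma isZero_homology_X₁_of_isIso (hS : S.ShortExact)
    (h : ∀ n, IsIso (Ψ.map (HomologicalComplex.homologyMap S.g n))) (n : ℤ) :
    IsZero (Ψ.obj (S.X₁.homology n)) := by
  have h₁ := (hS.homology_exact₁ (n - 1) n (by simp)).map Ψ
  have h₂ := (hS.homology_exact₂ n).map Ψ
  refine h₁.isZero_X₂ ?_ ?_
  · have := h (n - 1)
    refine (cancel_epi (Ψ.map (HomologicalComplex.homologyMap S.g (n - 1)))).1 ?_
    exact (((Ψ.map_comp _ _).symm.trans ((congrArg Ψ.map (hS.comp_δ _ _ _)).trans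
      (Ψ.map_zero _ _)))).trans comp_zero.symm
  · have := h n
    refine (cancel_mono (Ψ.map (HomologicalComplex.homologyMap S.g n))).1 ?_
    refine Eq.trans ?_ zero_comp.symm
    exact (Ψ.map_comp (HomologicalComplex.homologyMap S.f n) _).symm.trans
      ((congrArg Ψ.map (by rw [← HomologicalComplex.homologyMap_comp, S.zero,
        HomologicalComplex.homologyMap_zero])).trans (Ψ.map_zero _ _))

lemma isIso_homologyMap_g_of_isZero (hS : S.ShortExact)
    (h : ∀ n, IsZero (Ψ.obj (S.X₁.homology n))) (n : ℤ) :
    IsIso (Ψ.map (HomologicalComplex.homologyMap S.g n)) := by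
  have h₂ := (hS.homology_exact₂ n).map Ψ
  have h₃ := (hS.homology_exact₃ n (n + 1) (by simp)).map Ψ
  have : Mono (Ψ.map (HomologicalComplex.homologyMap S.g n)) := h₂.mono_g ((h n).eq_of_src _ _)
  have : Epi (Ψ.map (HomologicalComplex.homologyMap S.g n)) :=
    h₃.epi_f ((h (n + 1)).eq_of_tgt _ _)
  exact isIso_of_mono_of_epi _

end LongExactSequence

/-! ### Stalks of cohomology sheaves -/

section CohomologyStalks

variable {A : Type u} [CommRing A] {V Z : TopCat.{u}}

/-- The stalk at `x` of the `n`-th cohomology sheaf, as a functor on `D⁺(V)`. -/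
abbrev stalkH (A : Type u) [CommRing A] {V : TopCat.{u}} (n : ℤ) (x : V) :
    DPlus A V ⥤ ModuleCat.{u} A :=
  DerivedCategory.Plus.homologyFunctor (Sh A V) n ⋙ stalkAt A x

lemma isIso_of_isIso_stalkAt {F G : Sh A V} (φ : F ⟶ G) (h : ∀ x, IsIso ((stalkAt A x).map φ)) :
    IsIso φ :=
  (TopCat.Presheaf.isIso_iff_stalkFunctor_map_iso φ).2 h

lemma isZero_of_isZero_stalkAt {F : Sh A V} (h : ∀ x, IsZero ((stalkAt A x).obj F)) : IsZero F :=
  (TopCat.Sheaf.isZero_iff_stalkFunctor_obj_isZero F).2 h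

lemma isIso_of_isIso_stalkH {K L : DPlus A V} (φ : K ⟶ L)
    (h : ∀ n x, IsIso ((stalkH A n x).map φ)) : IsIso φ :=
  (DerivedCategory.Plus.isIso_iff φ).2 fun n ↦ isIso_of_isIso_stalkAt _ (h n)

/-- The cohomology sheaves of the object of `D⁺(V)` given by a complex. -/
def homologyFactors (A : Type u) [CommRing A] (V : TopCat.{u}) (n : ℤ) :
    DerivedCategory.Plus.Q ⋙ DerivedCategory.Plus.homologyFunctor (Sh A V) n ≅
      CochainComplex.Plus.ι (Sh A V) ⋙
        HomologicalComplex.homologyFunctor (Sh A V) (ComplexShape.up ℤ) n :=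
  Functor.isoWhiskerLeft (CochainComplex.Plus.ι (Sh A V))
    (DerivedCategory.homologyFunctorFactors (Sh A V) n)

/-- The cohomology sheaf in degree `0` of a sheaf is this sheaf. -/
def homologyZeroIso (A : Type u) [CommRing A] (V : TopCat.{u}) :
    inDegreeZero A V ⋙ DerivedCategory.Plus.homologyFunctor (Sh A V) 0 ≅ 𝟭 (Sh A V) :=
  DerivedCategory.singleFunctorCompHomologyFunctorIso (Sh A V) 0

lemma isZero_homology_inDegreeZero (F : Sh A V) {n : ℤ} (hn : n ≠ 0) :
    IsZero ((DerivedCategory.Plus.homologyFunctor (Sh A V) n).obj ((inDegreeZero A V).obj F)) := by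
  rcases lt_or_gt_of_ne hn with hn | hn
  · exact DerivedCategory.Plus.isZero_homology_of_isGE _ 0 n hn
  · exact DerivedCategory.Plus.isZero_homology_of_isLE _ 0 n hn

lemma isZero_stalkH_inDegreeZero (F : Sh A V) (x : V) (hF : IsZero ((stalkAt A x).obj F)) (n : ℤ) :
    IsZero ((stalkH A n x).obj ((inDegreeZero A V).obj F)) := by
  by_cases hn : n = 0
  · subst hn
    exact hF.of_iso ((stalkAt A x).mapIso ((homologyZeroIso A V).app F))
  · exact (stalkAt A x).map_isZero (isZero_homology_inDegreeZero F hn)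

lemma isIso_stalkH_inDegreeZero {F G : Sh A V} (φ : F ⟶ G) (x : V)
    (hφ : IsIso ((stalkAt A x).map φ)) (n : ℤ) :
    IsIso ((stalkH A n x).map ((inDegreeZero A V).map φ)) := by
  by_cases hn : n = 0
  · subst hn
    exact (NatIso.isIso_map_iff
      (Functor.isoWhiskerRight (homologyZeroIso A V) (stalkAt A x)) φ).2 hφ
  · exact ⟨0, ((stalkAt A x).map_isZero (isZero_homology_inDegreeZero F hn)).eq_of_src _ _,
      ((stalkAt A x).map_isZero (isZero_homology_inDegreeZero G hn)).eq_of_src _ _⟩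

lemma isIso_stalkH_Q_iff {K L : CochainComplex.Plus (Sh A V)} (π : K ⟶ L) (n : ℤ) (x : V) :
    IsIso ((stalkH A n x).map (DerivedCategory.Plus.Q.map π)) ↔
      IsIso ((stalkAt A x).map (HomologicalComplex.homologyMap π.hom n)) :=
  NatIso.isIso_map_iff (Functor.isoWhiskerRight (homologyFactors A V n) (stalkAt A x)) π

lemma isZero_stalkH_Q_iff (K : CochainComplex.Plus (Sh A V)) (n : ℤ) (x : V) :
    IsZero ((stalkH A n x).obj (DerivedCategory.Plus.Q.obj K)) ↔
      IsZero ((stalkAt A x).obj (K.obj.homology n)) :=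
  ((stalkAt A x).mapIso ((homologyFactors A V n).app K)).isZero_iff

/-- If a bounded below complex of injective sheaves is exact on the stalks at all points of a
compact fibre of a closed map, then its direct image is exact on the stalks at the image point. -/
lemma isZero_stalkAt_homology_push [T3Space V] {f : V ⟶ Z} (hf : IsClosedMap f)
    (K : CochainComplex (Sh A V) ℤ) (m : ℤ) [K.IsStrictlyGE m] (hK : ∀ n, Injective (K.X n))
    {z : Z} (hz : IsCompact (f ⁻¹' {z}))
    (h : ∀ n, ∀ x ∈ f ⁻¹' {z}, IsZero ((stalkAt A x).obj (K.homology n))) (n : ℤ) :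
    IsZero ((stalkAt A z).obj
      ((((push A f).mapHomologicalComplex (ComplexShape.up ℤ)).obj K).homology n)) := by
  rw [← exactNear_singleton_iff_isZero _ (n - 1) n (n + 1) (by lia) rfl]
  refine ExactNear.push hf (exactNear_of_isCompact K m
    (fun n O ↦ ?_) (f ⁻¹' {z}) (fun x hx i j k hij hjk ↦ ?_) _ _ _ (by lia) rfl _ hz subset_rfl)
  · have := hK n
    exact res_surjective_of_injective _ _
  · exact (exactNear_singleton_iff_isZero K i j k hij hjk x).2 (h j x hx)

lemma isZero_stalkAt_homology_push_of_singleton {f : V ⟶ Z} (hf : IsClosedMap f)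
    (K : CochainComplex (Sh A V) ℤ) {x : V} {z : Z} (hx : f ⁻¹' {z} = {x}) {n : ℤ}
    (h : IsZero ((stalkAt A x).obj (K.homology n))) :
    IsZero ((stalkAt A z).obj
      ((((push A f).mapHomologicalComplex (ComplexShape.up ℤ)).obj K).homology n)) := by
  rw [← exactNear_singleton_iff_isZero _ (n - 1) n (n + 1) (by lia) rfl]
  refine ExactNear.push hf ?_
  rw [hx]
  exact (exactNear_singleton_iff_isZero K _ _ _ (by lia) rfl x).2 h

end CohomologyStalks

/-! ### Degreewise split epimorphisms -/

section InjectiveKernel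

variable {C D : Type*} [Category* C] [Category* D] [Abelian C] [Abelian D]

/-- The short exact sequence formed by an epimorphism of complexes and its kernel. -/
abbrev kernelSequence {I J : CochainComplex C ℤ} (π : I ⟶ J) :
    ShortComplex (CochainComplex C ℤ) :=
  ShortComplex.mk (kernel.ι π) π (kernel.condition π)

lemma kernelSequence_shortExact {I J : CochainComplex C ℤ} (π : I ⟶ J) [Epi π] :
    (kernelSequence π).ShortExact where
  exact := ShortComplex.exact_of_f_is_kernel _ (kernelIsKernel π)

variable {I J : CochainComplex C ℤ} {π : I ⟶ J}

lemma injective_kernel_X (hπ : CochainComplex.degreewiseEpiWithInjectiveKernel π)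
    (n : ℤ) : Injective ((kernel π).X n) :=
  Injective.of_iso (asIso (kernelComparison π (HomologicalComplex.eval _ _ n))).symm (hπ n).2

lemma isStrictlyGE_kernel (π : I ⟶ J) (m : ℤ) [I.IsStrictlyGE m] :
    (kernel π).IsStrictlyGE m := by
  rw [CochainComplex.isStrictlyGE_iff]
  intro i hi
  rw [IsZero.iff_id_eq_zero, ← cancel_mono ((kernel.ι π).f i)]
  exact (I.isZero_of_isStrictlyGE m i hi).eq_of_tgt _ _

/-- Any additive functor preserves the exactness of the kernel sequence of a degreewise split
epimorphism. -/
lemma kernelSequence_map_shortExact (F : C ⥤ D) [F.Additive]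
    (hπ : CochainComplex.degreewiseEpiWithInjectiveKernel π) :
    ((kernelSequence π).map (F.mapHomologicalComplex (ComplexShape.up ℤ))).ShortExact := by
  have := hπ.epi
  refine HomologicalComplex.shortExact_of_degreewise_shortExact _ fun n ↦ ?_
  have h := (kernelSequence_shortExact π).map_of_exact (HomologicalComplex.eval C _ n)
  have : Injective ((kernelSequence π).map (HomologicalComplex.eval C _ n)).X₁ :=
    injective_kernel_X hπ n
  exact (h.splittingOfInjective.map F).shortExact

end InjectiveKernel

/-! ### Stalks of derived direct images -/

section DirectImage

lemma isIso_map_of_comm {C D : Type*} [Category* C] [Category* D] (Ψ : C ⥤ D) {P P' Q Q' : C}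
    {a : P ⟶ Q} {q : P' ⟶ Q'} {i : P ≅ P'} {j : Q ≅ Q'} (e : a ≫ j.hom = i.hom ≫ q)
    (hq : IsIso (Ψ.map q)) : IsIso (Ψ.map a) := by
  rw [← Iso.eq_comp_inv] at e
  rw [e, Functor.map_comp, Functor.map_comp]
  infer_instance

variable {A : Type u} [CommRing A] {V Z : TopCat.{u}} {f : V ⟶ Z}

/-- If a map of sheaves is an isomorphism on the stalks at all points of a compact fibre of a closed
map, then it induces isomorphisms on the stalks of the higher direct images at the image point. -/
lemma isIso_stalkH_Rpush_map [T3Space V] (hf : IsClosedMap f) {z : Z}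
    (hz : IsCompact (f ⁻¹' {z})) {F G : Sh A V} (φ : F ⟶ G)
    (h : ∀ x ∈ f ⁻¹' {z}, IsIso ((stalkAt A x).map φ)) (n : ℤ) :
    IsIso ((stalkH A n z).map ((Rpush A f).map ((inDegreeZero A V).map φ))) := by
  obtain ⟨I, J, α, β, π, hI, hJ, hα, hβ, hπ, comm⟩ := exists_injective_resolution_map φ
  have e := resolutionIso_naturality (push A f) (singlePlusMap φ) hI hJ α hα β hβ π comm
  have hπx (n : ℤ) (x : V) (hx : x ∈ f ⁻¹' {z}) :
      IsIso ((stalkAt A x).map (HomologicalComplex.homologyMap π.hom n)) := by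
    rw [← isIso_stalkH_Q_iff]
    have hαQ := isIso_Q_map α hα
    have hβQ := isIso_Q_map β hβ
    have hφ : IsIso ((stalkH A n x).map (DerivedCategory.Plus.Q.map (singlePlusMap φ))) :=
      isIso_stalkH_inDegreeZero φ x (h x hx) n
    have : DerivedCategory.Plus.Q.map π = inv (DerivedCategory.Plus.Q.map α) ≫
        DerivedCategory.Plus.Q.map (singlePlusMap φ) ≫ DerivedCategory.Plus.Q.map β := by
      rw [IsIso.eq_inv_comp, ← Functor.map_comp, comm, Functor.map_comp]
    rw [this, Functor.map_comp, Functor.map_comp]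
    infer_instance
  obtain ⟨m, hm⟩ := I.property
  have := isStrictlyGE_kernel π.hom m
  have := hπ.epi
  have hK (n : ℤ) : IsZero ((stalkAt A z).obj
      ((((push A f).mapHomologicalComplex (ComplexShape.up ℤ)).obj (kernel π.hom)).homology n)) :=
    isZero_stalkAt_homology_push hf _ m (injective_kernel_X hπ) hz (fun n x hx ↦
      isZero_homology_X₁_of_isIso (stalkAt A x) (kernelSequence_shortExact π.hom)
        (fun n ↦ hπx n x hx) n) n
  have hπz := isIso_homologyMap_g_of_isZero (stalkAt A z)
    (kernelSequence_map_shortExact (push A f) hπ) hK n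
  have hQ : IsIso ((stalkH A n z).map
      (DerivedCategory.Plus.Q.map ((push A f).mapCochainComplexPlus.map π))) :=
    (isIso_stalkH_Q_iff _ _ _).2 hπz
  exact isIso_map_of_comm (stalkH A n z) e hQ

lemma isZero_stalkH_Rpush_of_isZero [T3Space V] (hf : IsClosedMap f) {z : Z}
    (hz : IsCompact (f ⁻¹' {z})) (F : Sh A V)
    (h : ∀ x ∈ f ⁻¹' {z}, IsZero ((stalkAt A x).obj F)) (n : ℤ) :
    IsZero ((stalkH A n z).obj ((Rpush A f).obj ((inDegreeZero A V).obj F))) := by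
  obtain ⟨I, α, hI, hI', hα⟩ := exists_injective_resolution F
  refine IsZero.of_iso ?_ ((stalkH A n z).mapIso (resolutionIso (push A f) hI α hα))
  refine (isZero_stalkH_Q_iff _ _ _).2
    (isZero_stalkAt_homology_push hf I.obj 0 hI hz (fun n x hx ↦ ?_) n)
  have := isIso_Q_map α hα
  rw [← isZero_stalkH_Q_iff]
  exact (isZero_stalkH_inDegreeZero F x (h x hx) n).of_iso
    ((stalkH A n x).mapIso (asIso (DerivedCategory.Plus.Q.map α))).symm

/-- There are no higher direct images at a point with a single preimage. -/
lemma isZero_stalkH_Rpush_of_singleton (hf : IsClosedMap f) {x : V} {z : Z}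
    (hx : f ⁻¹' {z} = {x}) (F : Sh A V) {n : ℤ} (hn : n ≠ 0) :
    IsZero ((stalkH A n z).obj ((Rpush A f).obj ((inDegreeZero A V).obj F))) := by
  obtain ⟨I, α, hI, hI', hα⟩ := exists_injective_resolution F
  refine IsZero.of_iso ?_ ((stalkH A n z).mapIso (resolutionIso (push A f) hI α hα))
  refine (isZero_stalkH_Q_iff _ _ _).2 (isZero_stalkAt_homology_push_of_singleton hf I.obj hx ?_)
  have := isIso_Q_map α hα
  rw [← isZero_stalkH_Q_iff]
  exact ((stalkAt A x).map_isZero (isZero_homology_inDegreeZero F hn)).of_iso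
    ((stalkH A n x).mapIso (asIso (DerivedCategory.Plus.Q.map α))).symm

/-- The canonical isomorphism between a direct image in degree `0` and the direct image of a complex
concentrated in degree `0`. -/
def singlePushIso (f : V ⟶ Z) (F : Sh A V) :
    singlePlus ((push A f).obj F) ≅ (push A f).mapCochainComplexPlus.obj (singlePlus F) :=
  ObjectProperty.isoMk _ ((HomologicalComplex.singleMapHomologicalComplex (push A f)
    (ComplexShape.up ℤ) 0).app F).symm

lemma singlePushIso_naturality (f : V ⟶ Z) {F G : Sh A V} (φ : F ⟶ G) :
    singlePlusMap ((push A f).map φ) ≫ (singlePushIso f G).hom =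
      (singlePushIso f F).hom ≫ (push A f).mapCochainComplexPlus.map (singlePlusMap φ) := by
  ext : 1
  exact (HomologicalComplex.singleMapHomologicalComplex (push A f)
    (ComplexShape.up ℤ) 0).inv.naturality φ

lemma pushToRpush_eq (f : V ⟶ Z) (F : Sh A V) :
    pushToRpush A f F =
      DerivedCategory.Plus.Q.map (singlePushIso f F).hom ≫ toDerived (push A f) (singlePlus F) := by
  refine congrArg (· ≫ toDerived (push A f) (singlePlus F)) ?_
  apply DerivedCategory.Plus.ι.map_injective
  exact DerivedCategory.Plus.ι.map_preimage _

lemma pushToRpush_naturality (f : V ⟶ Z) {F G : Sh A V} (φ : F ⟶ G) :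
    (inDegreeZero A Z).map ((push A f).map φ) ≫ pushToRpush A f G =
      pushToRpush A f F ≫ (Rpush A f).map ((inDegreeZero A V).map φ) := by
  rw [pushToRpush_eq, pushToRpush_eq]
  refine (Category.assoc _ _ _).symm.trans (Eq.trans ?_ (Category.assoc _ _ _).symm)
  refine Eq.trans ?_ (congrArg _ (toDerived_naturality (push A f) (singlePlusMap φ)))
  refine Eq.trans ?_ (Category.assoc _ _ _)
  refine congrArg (· ≫ toDerived (push A f) (singlePlus G)) ?_
  exact ((DerivedCategory.Plus.Q.map_comp (singlePlusMap _) _).symm.trans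
    (congrArg DerivedCategory.Plus.Q.map (singlePushIso_naturality f φ))).trans
    (DerivedCategory.Plus.Q.map_comp _ _)

/-- The canonical morphism `f_* F ⟶ Rf_* F` induces an isomorphism on `H⁰`. -/
lemma isIso_homologyZero_pushToRpush (f : V ⟶ Z) (F : Sh A V) :
    IsIso ((DerivedCategory.Plus.homologyFunctor (Sh A Z) 0).map (pushToRpush A f F)) := by
  obtain ⟨I, α, hI, hI', hα⟩ := exists_injective_resolution F
  have h0 : QuasiIsoAt ((push A f).mapCochainComplexPlus.map α).hom 0 :=
    quasiIsoAt_zero_map_of_quasiIsoAt (push A f) α.hom (hα.quasiIsoAt 0)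
  have h1 : IsIso ((DerivedCategory.Plus.homologyFunctor (Sh A Z) 0).map
      (DerivedCategory.Plus.Q.map ((push A f).mapCochainComplexPlus.map α))) :=
    (NatIso.isIso_map_iff (homologyFactors A Z 0) _).2
      ((quasiIsoAt_iff_isIso_homologyMap _ _).1 h0)
  refine isIso_map_of_comm (i := DerivedCategory.Plus.Q.mapIso (singlePushIso f F))
    (j := resolutionIso (push A f) hI α hα) _ ?_ h1
  rw [pushToRpush_eq]
  exact (Category.assoc _ _ _).trans (congrArg _ (toDerived_resolutionIso_hom (push A f) hI α hα))

/-- The canonical morphism `A_Z ⟶ Rf_* A_V`. -/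
def constToRpush (A : Type u) [CommRing A] (f : V ⟶ Z) :
    AA A Z ⟶ (Rpush A f).obj (AA A V) :=
  (inDegreeZero A Z).map (constToPush A f) ≫ pushToRpush A f (constSheaf A V)

lemma isIso_stalkH_constToRpush (hf : IsClosedMap f) {x : V} {z : Z} (hx : f ⁻¹' {z} = {x})
    (n : ℤ) : IsIso ((stalkH A n z).map (constToRpush A f)) := by
  by_cases hn : n = 0
  · subst hn
    have := isIso_homologyZero_pushToRpush f (constSheaf A V)
    have := isIso_stalkH_inDegreeZero (constToPush A f) z (isIso_stalkAt_constToPush hf hx) 0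
    have : IsIso ((stalkH A 0 z).map (pushToRpush A f (constSheaf A V))) :=
      inferInstanceAs (IsIso ((stalkAt A z).map
        ((DerivedCategory.Plus.homologyFunctor (Sh A Z) 0).map _)))
    rw [constToRpush, Functor.map_comp]
    infer_instance
  · have h1 := (stalkAt A z).map_isZero (isZero_homology_inDegreeZero (constSheaf A Z) hn)
    have h2 := isZero_stalkH_Rpush_of_singleton hf hx (constSheaf A V) hn
    exact ⟨0, h1.eq_of_src _ _, h2.eq_of_src _ _⟩

end DirectImage

/-! ### The matrix of a splitting -/

section SplittingMatrix

variable {C E : Type*} [Category* C] [Category* E] [Preadditive C] [Preadditive E]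
  [HasBinaryBiproducts C] [HasBinaryBiproducts E]

/-- In a square `u ≫ r = c ≫ g` with `u` split by `θ`, the matrix built from `r`, `g` and `θ` is
invertible as soon as `r` and `c` are. -/
lemma isIso_matrix_of_isIso {R Q N Y : E} {u : Y ⟶ R} {r : R ⟶ N} {c : Y ⟶ Q} {g : Q ⟶ N}
    {θ : R ⟶ Y} (sq : u ≫ r = c ≫ g) (hθ : u ≫ θ = 𝟙 Y) [IsIso r] [IsIso c] :
    IsIso (biprod.lift (biprod.desc r g) (biprod.desc θ 0)) := by
  have hg : g = inv c ≫ u ≫ r := by rw [sq, IsIso.inv_hom_id_assoc]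
  -- solving for the second component gives `t ≫ c`, where `t` measures the defect of `θ` on the
  -- preimage under `r`
  let t : N ⊞ Y ⟶ Y := biprod.fst ≫ inv r ≫ θ - biprod.snd
  refine ⟨biprod.lift (biprod.fst ≫ inv r - t ≫ u) (t ≫ c), ?_, ?_⟩
  · ext <;> simp [t, hg, reassoc_of% hθ]
  · ext <;> simp [t, hg, hθ]

lemma isIso_matrix_of_isZero {R Q N Y : E} {u : Y ⟶ R} {r : R ⟶ N} {g : Q ⟶ N}
    {θ : R ⟶ Y} (hθ : u ≫ θ = 𝟙 Y) [IsIso u] (hQ : IsZero Q) (hN : IsZero N) :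
    IsIso (biprod.lift (biprod.desc r g) (biprod.desc θ 0)) := by
  have hθ' : θ = inv u := (IsIso.inv_eq_of_hom_inv_id hθ).symm
  refine ⟨biprod.snd ≫ u ≫ biprod.inl, ?_, ?_⟩
  · ext
    · simp [hθ']
    · simp [hθ']
    · exact hQ.eq_of_src _ _
    · exact hQ.eq_of_src _ _
  · ext
    · exact hN.eq_of_src _ _
    · exact hN.eq_of_src _ _
    · exact hN.eq_of_tgt _ _
    · simp [hθ']

lemma isIso_map_matrix (Ψ : C ⥤ E) [Ψ.Additive] {R Q N Y : C} {r : R ⟶ N} {g : Q ⟶ N} {θ : R ⟶ Y}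
    (h : IsIso (biprod.lift (biprod.desc (Ψ.map r) (Ψ.map g)) (biprod.desc (Ψ.map θ) 0))) :
    IsIso (Ψ.map (biprod.lift (biprod.desc r g) (biprod.desc θ 0))) := by
  have := preservesBinaryBiproducts_of_preservesBiproducts Ψ
  have key : Ψ.map (biprod.lift (biprod.desc r g) (biprod.desc θ 0)) =
      (Ψ.mapBiprod _ _).hom ≫
        biprod.lift (biprod.desc (Ψ.map r) (Ψ.map g)) (biprod.desc (Ψ.map θ) 0) ≫
          (Ψ.mapBiprod _ _).inv := by
    rw [← Category.assoc, Iso.eq_comp_inv, Functor.mapBiprod_hom, Functor.mapBiprod_hom]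
    ext <;> simp only [Category.assoc, biprod.lift_fst, biprod.lift_snd, ← Functor.map_comp] <;>
      simp [biprod.desc_eq]
  rw [key]
  infer_instance

end SplittingMatrix

/-! ### Classes of degree one -/

section DegreeOne

variable {A : Type u} [CommRing A] {X Y : TopCat.{u}} {f : X ⟶ Y}

lemma constToRpush_comp (θ : (Rpush A f).obj (AA A X) ⟶ AA A Y) :
    constToRpush A f ≫ θ =
      (inDegreeZero A Y).map (constToPush A f ≫ degreeZeroPart f θ) := by
  rw [constToRpush, Category.assoc, Functor.map_comp, degreeZeroPart, Functor.map_preimage]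

instance inDegreeZero_faithful (A : Type u) [CommRing A] (V : TopCat.{u}) :
    (inDegreeZero A V).Faithful :=
  ⟨fun {F G φ ψ} h ↦ by
    have := NatIso.naturality_1 (homologyZeroIso A V) φ
    have h' := NatIso.naturality_1 (homologyZeroIso A V) ψ
    rw [Functor.comp_map, h] at this
    exact this.symm.trans h'⟩

/-- A class has degree one if and only if it splits the canonical morphism `A_Y ⟶ Rf_* A_X`. -/
lemma hasDegreeOne_iff (θ : (Rpush A f).obj (AA A X) ⟶ AA A Y) :
    HasDegreeOne f θ ↔ constToRpush A f ≫ θ = 𝟙 _ := by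
  rw [constToRpush_comp, ← (inDegreeZero A Y).map_id, (inDegreeZero A Y).map_injective.eq_iff]
  have h : onSec (constToPush A f ≫ degreeZeroPart f θ) ⊤ (oneClass A Y) =
      (gysin f θ).hom (oneClass A X) :=
    congrArg (onSec (degreeZeroPart f θ) ⊤) (onSec_constToPush f)
  refine ⟨fun hθ ↦ constSheaf_hom_ext (h.trans hθ), fun e ↦ h.symm.trans ?_⟩
  rw [e, onSec_id]

/-- On a connected space, a morphism `Rf_* A_X ⟶ A_Y` which is surjective on one stalk in degree `0`
can be multiplied by a unit of `A` to become a class of degree one, provided that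
`A_Y ⟶ Rf_* A_X` is an isomorphism there. -/
lemma exists_hasDegreeOne [PreconnectedSpace Y] (p : (Rpush A f).obj (AA A X) ⟶ AA A Y) (y : Y)
    (hu : IsIso ((stalkH A 0 y).map (constToRpush A f))) (hp : Epi ((stalkH A 0 y).map p)) :
    ∃ θ : (Rpush A f).obj (AA A X) ⟶ AA A Y, HasDegreeOne f θ := by
  let e := constToPush A f ≫ degreeZeroPart f p
  have : Nonempty Y := ⟨y⟩
  obtain ⟨a, ha⟩ := exists_eq_smul_oneClass (A := A) (V := Y) (onSec e ⊤ (oneClass A Y))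
  have hepi : Epi ((stalkH A 0 y).map ((inDegreeZero A Y).map e)) := by
    rw [← constToRpush_comp, Functor.map_comp]
    infer_instance
  have hepi' : Epi ((stalkAt A y).map e) := by
    let i := Functor.isoWhiskerRight (homologyZeroIso A Y) (stalkAt A y)
    have h : (stalkAt A y).map e = i.inv.app _ ≫ (stalkH A 0 y).map ((inDegreeZero A Y).map e) ≫
        i.hom.app _ := (NatIso.naturality_1 i e).symm
    rw [h]
    exact epi_comp' inferInstance (epi_comp' hepi inferInstance)
  -- the scalar `a` is a unit because the germ of `1` is in the image
  obtain ⟨t, ht⟩ := (ModuleCat.epi_iff_surjective _).1 hepi' (germOne A y)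
  obtain ⟨b, rfl⟩ := (smul_germOne_bijective y).2 t
  have hba : b * a = 1 := by
    refine (smul_germOne_bijective (A := A) y).1 ?_
    dsimp only
    rw [map_smul] at ht
    have h : ((stalkAt A y).map e).hom (germOne A y) = a • germOne A y := by
      refine (stalkAt_map_germAt e ⊤ y trivial _).trans ?_
      rw [ha, map_smul]
    rw [mul_smul, one_smul, ← h]
    exact ht
  refine ⟨p ≫ (inDegreeZero A Y).map (ofSec (F := constSheaf A Y) (b • oneClass A Y)), ?_⟩
  rw [hasDegreeOne_iff, ← Category.assoc, constToRpush_comp, ← Functor.map_comp,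
    ← (inDegreeZero A Y).map_id]
  congr 1
  refine constSheaf_hom_ext ?_
  rw [onSec_comp, ha, map_smul, onSec_ofSec, smul_smul, mul_comm, hba, one_smul, onSec_id]

end DegreeOne

/-! ### Restriction to closed subspaces -/

section RestrictionSquare

variable {A : Type u} [CommRing A] {X Y : TopCat.{u}} {f : X ⟶ Y}

/-- The restriction `A_V ⟶ A_S` to a subspace. -/
def toConstOn (A : Type u) [CommRing A] {V : TopCat.{u}} (S : Set V) : AA A V ⟶ AAOn A S :=
  (inDegreeZero A V).map (constToPush A (incl S))

/-- The restriction `Rf_* A_X ⟶ Rf_* A_S`. -/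
def RpushToConstOn (A : Type u) [CommRing A] (f : X ⟶ Y) (S : Set X) :
    (Rpush A f).obj (AA A X) ⟶ (Rpush A f).obj (AAOn A S) :=
  (Rpush A f).map (toConstOn A S)

/-- The restriction of `f` to a map from the preimage of `W` to `W`. -/
def restrictTo (f : X ⟶ Y) (W : Set Y) : TopCat.of (f ⁻¹' W) ⟶ TopCat.of W :=
  TopCat.ofHom ⟨W.restrictPreimage f, f.hom.continuous.restrictPreimage⟩

/-- The canonical morphism `A_W ⟶ f_* A_{f⁻¹(W)}` of sheaves on the target. The direct
images along the two sides of the square formed by `f`, its restriction and the inclusions agree by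
definition. -/
def constOnToPush (A : Type u) [CommRing A] (f : X ⟶ Y) (W : Set Y) :
    constSheafOn A W ⟶ (push A f).obj (constSheafOn A (f ⁻¹' W)) :=
  (push A (incl W)).map (constToPush A (restrictTo f W))

/-- The canonical morphism `A_W ⟶ Rf_* A_{f⁻¹(W)}`. -/
def constOnToRpush (A : Type u) [CommRing A] (f : X ⟶ Y) (W : Set Y) :
    AAOn A W ⟶ (Rpush A f).obj (AAOn A (f ⁻¹' W)) :=
  (inDegreeZero A Y).map (constOnToPush A f W) ≫ pushToRpush A f _

lemma restriction_square (f : X ⟶ Y) (W : Set Y) :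
    constToRpush A f ≫ RpushToConstOn A f (f ⁻¹' W) = toConstOn A W ≫ constOnToRpush A f W := by
  have key : constToPush A f ≫ (push A f).map (constToPush A (incl (f ⁻¹' W))) =
      constToPush A (incl W) ≫ constOnToPush A f W := by
    apply constSheaf_hom_ext
    rw [onSec_comp, onSec_comp, onSec_constToPush, onSec_constToPush]
    exact (onSec_constToPush (incl (f ⁻¹' W))).trans (onSec_constToPush (restrictTo f W)).symm
  rw [constToRpush, RpushToConstOn, toConstOn, toConstOn, constOnToRpush, Category.assoc,
    ← pushToRpush_naturality, ← Category.assoc, ← Category.assoc, ← Functor.map_comp,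
    ← Functor.map_comp, key]

lemma isClosedMap_incl {V : TopCat.{u}} {S : Set V} (hS : IsClosed S) : IsClosedMap (incl S) :=
  hS.isClosedEmbedding_subtypeVal.isClosedMap

lemma isIso_stalkAt_constToPush_incl {V : TopCat.{u}} {S : Set V} (hS : IsClosed S) {x : V}
    (hx : x ∈ S) : IsIso ((stalkAt A x).map (constToPush A (incl S))) :=
  isIso_stalkAt_constToPush (isClosedMap_incl hS) (x := ⟨x, hx⟩) (by
    ext z
    exact (Subtype.ext_iff (a1 := z) (a2 := ⟨x, hx⟩)).symm)

lemma isZero_stalkAt_constSheafOn {V : TopCat.{u}} {S : Set V} (hS : IsClosed S) {x : V}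
    (hx : x ∉ S) : IsZero ((stalkAt A x).obj (constSheafOn A S)) :=
  isZero_stalkAt_push_of_isEmpty (isClosedMap_incl hS) _
    (Set.eq_empty_of_forall_notMem fun z (hz : z.1 = x) ↦ hx (hz ▸ z.2))

variable {W : Set Y}

lemma isIso_stalkH_toConstOn (hW : IsClosed W) {y : Y} (hy : y ∈ W) (n : ℤ) :
    IsIso ((stalkH A n y).map (toConstOn A W)) :=
  isIso_stalkH_inDegreeZero _ y (isIso_stalkAt_constToPush_incl hW hy) n

lemma isZero_stalkH_AAOn (hW : IsClosed W) {y : Y} (hy : y ∉ W) (n : ℤ) :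
    IsZero ((stalkH A n y).obj (AAOn A W)) :=
  isZero_stalkH_inDegreeZero _ y (isZero_stalkAt_constSheafOn hW hy) n

lemma isIso_stalkH_RpushToConstOn [T3Space X] (hf : IsProperMap f) (hW : IsClosed W) {y : Y}
    (hy : y ∈ W) (n : ℤ) : IsIso ((stalkH A n y).map (RpushToConstOn A f (f ⁻¹' W))) :=
  isIso_stalkH_Rpush_map hf.isClosedMap (hf.isCompact_preimage isCompact_singleton) _
    (fun _ hx ↦ isIso_stalkAt_constToPush_incl (hW.preimage f.hom.continuous)
      (Set.preimage_mono (Set.singleton_subset_iff.2 hy) hx)) n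

lemma isZero_stalkH_Rpush_AAOn [T3Space X] (hf : IsProperMap f) (hW : IsClosed W) {y : Y}
    (hy : y ∉ W) (n : ℤ) : IsZero ((stalkH A n y).obj ((Rpush A f).obj (AAOn A (f ⁻¹' W)))) :=
  isZero_stalkH_Rpush_of_isZero hf.isClosedMap (hf.isCompact_preimage isCompact_singleton) _
    (fun x hx ↦ isZero_stalkAt_constSheafOn (hW.preimage f.hom.continuous)
      (fun h ↦ hy (by rw [← show f x = y from hx]; exact h))) n

end RestrictionSquare

/-! ### Splittings and decompositions -/

section Equivalence

variable {A : Type u} [CommRing A] {X Y : TopCat.{u}} {f : X ⟶ Y} {W : Set Y}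

/-- In a pretriangulated category, a split monomorphism is the inclusion of a direct summand. -/
lemma exists_biproduct_of_split {C : Type*} [Category* C] [HasZeroObject C] [HasShift C ℤ]
    [Preadditive C] [∀ n : ℤ, (shiftFunctor C n).Additive] [Pretriangulated C] {P R : C}
    (u : P ⟶ R) (θ : R ⟶ P) (h : u ≫ θ = 𝟙 P) : ∃ K : C, Nonempty (R ≅ P ⊞ K) := by
  obtain ⟨K, v, w, hT⟩ := Pretriangulated.distinguished_cocone_triangle u
  have : Mono u := mono_of_mono_fac h
  obtain ⟨e, -⟩ := Pretriangulated.exists_iso_binaryBiproduct_of_distTriang _ hT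
    ((Pretriangulated.Triangle.mor₃_eq_zero_iff_mono₁ _ hT).2 this)
  exact ⟨K, ⟨e⟩⟩

lemma exists_iso_of_hasDegreeOne [T3Space X] (hf : IsProperMap f) (hW : IsClosed W)
    (hfW : ∀ y ∉ W, ∃ x, f ⁻¹' {y} = {x}) (θ : (Rpush A f).obj (AA A X) ⟶ AA A Y)
    (hθ : HasDegreeOne f θ) :
    Nonempty ((Rpush A f).obj (AA A X) ⊞ AAOn A W ≅
      (Rpush A f).obj (AAOn A (f ⁻¹' W)) ⊞ AA A Y) := by
  rw [hasDegreeOne_iff] at hθ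
  have hiso := isIso_of_isIso_stalkH (biprod.lift
    (biprod.desc (RpushToConstOn A f (f ⁻¹' W)) (constOnToRpush A f W)) (biprod.desc θ 0))
    (fun n y ↦ by
      have hθ' : (stalkH A n y).map (constToRpush A f) ≫ (stalkH A n y).map θ = 𝟙 _ := by
        rw [← Functor.map_comp, hθ, CategoryTheory.Functor.map_id]
      refine isIso_map_matrix (stalkH A n y) ?_
      by_cases hy : y ∈ W
      · have := isIso_stalkH_RpushToConstOn (A := A) hf hW hy n
        have := isIso_stalkH_toConstOn (A := A) hW hy n
        refine isIso_matrix_of_isIso (u := (stalkH A n y).map (constToRpush A f))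
          (c := (stalkH A n y).map (toConstOn A W)) ?_ hθ'
        rw [← Functor.map_comp, ← Functor.map_comp, restriction_square]
      · obtain ⟨x, hx⟩ := hfW y hy
        have := isIso_stalkH_constToRpush (A := A) hf.isClosedMap hx n
        exact isIso_matrix_of_isZero hθ' (isZero_stalkH_AAOn hW hy n)
          (isZero_stalkH_Rpush_AAOn hf hW hy n))
  exact ⟨asIso (biprod.lift
    (biprod.desc (RpushToConstOn A f (f ⁻¹' W)) (constOnToRpush A f W)) (biprod.desc θ 0))⟩

lemma tfae_hasDegreeOne [T3Space X] [PreconnectedSpace Y] (hf : IsProperMap f) (hW : IsClosed W)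
    (hfW : ∀ y ∉ W, ∃ x, f ⁻¹' {y} = {x}) (hne : Wᶜ.Nonempty) :
    List.TFAE [
      ∃ θ : (Rpush A f).obj (AA A X) ⟶ AA A Y, HasDegreeOne f θ,
      Nonempty ((Rpush A f).obj (AA A X) ⊞ AAOn A W ≅
        (Rpush A f).obj (AAOn A (f ⁻¹' W)) ⊞ AA A Y),
      ∃ K : DPlus A Y, Nonempty ((Rpush A f).obj (AA A X) ≅ AA A Y ⊞ K)] := by
  obtain ⟨y, hy⟩ := hne
  obtain ⟨x, hx⟩ := hfW y hy
  have hu := isIso_stalkH_constToRpush (A := A) hf.isClosedMap hx 0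
  tfae_have 1 → 2 := fun ⟨θ, hθ⟩ ↦ exists_iso_of_hasDegreeOne hf hW hfW θ hθ
  tfae_have 1 → 3 := fun ⟨θ, hθ⟩ ↦
    exists_biproduct_of_split _ θ ((hasDegreeOne_iff θ).1 hθ)
  tfae_have 3 → 1 := fun ⟨K, ⟨e⟩⟩ ↦
    exists_hasDegreeOne (e.hom ≫ biprod.fst) y hu inferInstance
  tfae_have 2 → 1 := fun ⟨e⟩ ↦ by
    -- over the complement of `W`, the first inclusion is an isomorphism on stalks
    refine exists_hasDegreeOne (biprod.inl ≫ e.hom ≫ biprod.snd) y hu ?_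
    have hinl : IsSplitEpi ((stalkH A 0 y).map
        (biprod.inl : (Rpush A f).obj (AA A X) ⟶ _ ⊞ AAOn A W)) := by
      refine ⟨⟨⟨(stalkH A 0 y).map biprod.fst, ?_⟩⟩⟩
      have h0 : (stalkH A 0 y).map (biprod.snd : (Rpush A f).obj (AA A X) ⊞ AAOn A W ⟶ _) = 0 :=
        (isZero_stalkH_AAOn hW hy 0).eq_of_tgt _ _
      have ht := congrArg (stalkH A 0 y).map (biprod.total (X := (Rpush A f).obj (AA A X))
        (Y := AAOn A W))
      rw [Functor.map_add, Functor.map_comp, Functor.map_comp _ biprod.snd, h0, zero_comp, add_zero,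
        CategoryTheory.Functor.map_id] at ht
      exact ht
    have : Epi ((stalkH A 0 y).map (e.hom ≫ (biprod.snd : _ ⊞ AA A Y ⟶ _))) := inferInstance
    rw [Functor.map_comp]
    exact epi_comp' inferInstance this
  tfae_finish

end Equivalence

/-! ### Inverse images -/

section InverseImages

variable {A : Type u} [CommRing A] {V V' Z : TopCat.{u}}

/-- The adjunction between inverse and direct images. -/
abbrev pullPushAdj (A : Type u) [CommRing A] (g : V ⟶ Z) : pull A g ⊣ push A g :=
  TopCat.Sheaf.pullbackPushforwardAdjunction (ModuleCat.{u} A) g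

/-- The adjunction between constant sheaves and global sections. -/
abbrev constAdj (A : Type u) [CommRing A] (V : TopCat.{u}) :=
  constantSheafAdj (Opens.grothendieckTopology V) (ModuleCat.{u} A)
    (isTerminalTop : IsTerminal (⊤ : Opens V))

/-- Inverse images are compatible with composition. -/
def pullCompIso (A : Type u) [CommRing A] (j : V' ⟶ V) (i : V ⟶ Z) :
    pull A i ⋙ pull A j ≅ pull A (j ≫ i) :=
  Adjunction.leftAdjointUniq ((pullPushAdj A i).comp (pullPushAdj A j)) (pullPushAdj A (j ≫ i))

/-- The morphism of constant sheaves given by a linear map. -/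
def constMap {M N : ModuleCat.{u} A} (k : M →ₗ[A] N) (V : TopCat.{u}) :
    constSheafOf M V ⟶ constSheafOf N V :=
  (constantSheaf (Opens.grothendieckTopology V) (ModuleCat.{u} A)).map (ModuleCat.ofHom k)

@[simp]
lemma onSec_constMap {M N : ModuleCat.{u} A} (k : M →ₗ[A] N) (m : M) :
    onSec (constMap k V) ⊤ (constSec M V m) = constSec N V (k m) :=
  (congrArg (fun l ↦ l.hom m) ((constAdj A V).unit.naturality (ModuleCat.ofHom k))).symm

/-- The inverse image of a constant sheaf is a constant sheaf. -/
def pullConstIso (g : V ⟶ Z) (M : ModuleCat.{u} A) :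
    (pull A g).obj (constSheafOf M Z) ≅ constSheafOf M V :=
  (Adjunction.leftAdjointUniq ((constAdj A Z).comp (pullPushAdj A g)) (constAdj A V)).app M

/-- The canonical morphism `M_Z ⟶ g_* M_V`. -/
def constSheafOfToPush (g : V ⟶ Z) (M : ModuleCat.{u} A) :
    constSheafOf M Z ⟶ (push A g).obj (constSheafOf M V) :=
  constSheafOfDesc (F := (push A g).obj (constSheafOf M V)) (constSec M V)

lemma onSec_constSheafOfToPush (g : V ⟶ Z) (M : ModuleCat.{u} A) (m : M) :
    onSec (constSheafOfToPush g M) ⊤ (constSec M Z m) = constSec M V m :=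
  onSec_constSheafOfDesc (F := (push A g).obj (constSheafOf M V)) (constSec M V) m

lemma homEquiv_pullConstIso (g : V ⟶ Z) (M : ModuleCat.{u} A) :
    (pullPushAdj A g).homEquiv _ _ (pullConstIso g M).hom = constSheafOfToPush g M := by
  have h := Adjunction.homEquiv_leftAdjointUniq_hom_app ((constAdj A Z).comp (pullPushAdj A g))
    (constAdj A V) M
  apply ((constAdj A Z).homEquiv _ _).injective
  refine ((DFunLike.congr_fun (congrFun (congrFun
    (Adjunction.comp_homEquiv (constAdj A Z) (pullPushAdj A g)) _) _) _).symm.trans h).trans ?_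
  exact (((constAdj A Z).homEquiv M ((push A g).obj (constSheafOf M V))).apply_symm_apply
    (ModuleCat.ofHom (constSec M V))).symm

open Classical in
/-- The stalks of an inverse image: both functors are left adjoint to skyscraper sheaves, as the
direct image of a skyscraper sheaf is a skyscraper sheaf, by definition. -/
def pullStalkIso (A : Type u) [CommRing A] (g : V ⟶ Z) (x : V) :
    pull A g ⋙ stalkAt A x ≅ stalkAt A (g x) :=
  Adjunction.leftAdjointUniq
    ((pullPushAdj A g).comp (stalkSkyscraperSheafAdjunction x (C := ModuleCat.{u} A)))
    (stalkSkyscraperSheafAdjunction (g x) (C := ModuleCat.{u} A))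

lemma isIso_pull_map (g : V ⟶ Z) {F G : Sh A Z} (φ : F ⟶ G)
    (h : ∀ x : V, IsIso ((stalkAt A (g x)).map φ)) : IsIso ((pull A g).map φ) :=
  isIso_of_isIso_stalkAt _ fun x ↦ (NatIso.isIso_map_iff (pullStalkIso A g x) φ).2 (h x)

lemma isZero_pull (g : V ⟶ Z) {F : Sh A Z}
    (h : ∀ x : V, IsZero ((stalkAt A (g x)).obj F)) : IsZero ((pull A g).obj F) :=
  isZero_of_isZero_stalkAt fun x ↦ (h x).of_iso ((pullStalkIso A g x).app F)

end InverseImages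

/-! ### Constructible sheaves -/

section Constructible

variable {A : Type u} [CommRing A] {V : TopCat.{u}}

/-- The inclusion between two subspaces. -/
def inclLE {S T : Set V} (h : T ⊆ S) : TopCat.of T ⟶ TopCat.of S :=
  TopCat.ofHom ⟨Set.inclusion h, continuous_inclusion h⟩

/-- Restriction of a sheaf to a subspace through a larger subspace. -/
def pullInclIso (F : Sh A V) {S T : Set V} (h : T ⊆ S) :
    (pull A (inclLE h)).obj ((pull A (incl S)).obj F) ≅ (pull A (incl T)).obj F :=
  (pullCompIso A (inclLE h) (incl S)).app F

/-- A sheaf which is constant on a subspace is constant on every smaller one. -/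
def pullInclConstIso {F : Sh A V} {S T : Set V} (h : T ⊆ S) {M : ModuleCat.{u} A}
    (e : (pull A (incl S)).obj F ≅ constSheafOf M (TopCat.of S)) :
    (pull A (incl T)).obj F ≅ constSheafOf M (TopCat.of T) :=
  (pullInclIso F h).symm ≪≫ (pull A (inclLE h)).mapIso e ≪≫ pullConstIso (inclLE h) M

lemma isConstructible_constSheaf (A : Type u) [CommRing A] (V : TopCat.{u}) :
    IsConstructible (constSheaf A V) := by
  refine ⟨PUnit, fun _ ↦ Set.univ, Set.iUnion_const _, fun i j h ↦ (h rfl).elim,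
    locallyFinite_of_finite _, fun _ ↦ isClosed_univ.isLocallyClosed,
    fun _ s _ ↦ ⟨Set.univ, isOpen_univ, trivial,
      ModuleCat.of A A, inferInstanceAs (Module.Finite A A), ⟨pullConstIso _ _⟩⟩⟩

/-- Constructibility is transported along a map which is an isomorphism on the stalks over a closed
subset, to a sheaf with zero stalks elsewhere. -/
lemma IsConstructible.of_isIso_stalkAt {F G : Sh A V} (hF : IsConstructible F) (φ : F ⟶ G)
    {W : Set V} (hW : IsClosed W) (h : ∀ x ∈ W, IsIso ((stalkAt A x).map φ))
    (h' : ∀ x ∉ W, IsZero ((stalkAt A x).obj G)) : IsConstructible G := by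
  obtain ⟨ι, S, hS, hS', hfin, hloc, hF⟩ := hF
  -- the stratum `none` is the complement of `W`, where `G` vanishes
  refine ⟨Option ι, fun o ↦ o.elim Wᶜ (fun i ↦ S i ∩ W), ?_, ?_, ?_, ?_, ?_⟩
  · rw [Set.iUnion_option]
    simp only [Option.elim_none, Option.elim_some, ← Set.iUnion_inter, hS, Set.univ_inter]
    exact Set.compl_union_self W
  · rintro (_ | i) (_ | j) hij
    · exact (hij rfl).elim
    · exact disjoint_compl_left.mono_right Set.inter_subset_right
    · exact disjoint_compl_right.mono_left Set.inter_subset_right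
    · exact (hS' fun e ↦ hij (congrArg some e)).mono Set.inter_subset_left Set.inter_subset_left
  · have := (hfin.subset (g := fun i ↦ S i ∩ W) fun i ↦ Set.inter_subset_left).option_elim' Wᶜ
    refine this.subset ?_
    rintro (_ | i) <;> exact subset_rfl
  · rintro (_ | i)
    · exact hW.isOpen_compl.isLocallyClosed
    · exact (hloc i).inter hW.isLocallyClosed
  · rintro (_ | i) s hs
    · refine ⟨Set.univ, isOpen_univ, trivial, ModuleCat.of A PUnit, inferInstance,
        ⟨IsZero.iso ?_ ?_⟩⟩
      · exact isZero_pull _ fun x ↦ h' _ x.2.1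
      · refine (IsZero.iff_id_eq_zero _).2 (constSheafOf_hom_ext fun m ↦ ?_)
        rw [show m = 0 from Subsingleton.elim (α := PUnit) _ _, map_zero, map_zero, map_zero]
    · obtain ⟨O, hO, hsO, M, hM, ⟨e⟩⟩ := hF i s hs.1
      have hsub : (S i ∩ W) ∩ O ⊆ S i ∩ O := Set.inter_subset_inter_left _ Set.inter_subset_left
      have := isIso_pull_map (incl ((S i ∩ W) ∩ O)) φ fun x ↦ h _ x.2.1.2
      exact ⟨O, hO, hsO, M, hM, ⟨(asIso ((pull A (incl ((S i ∩ W) ∩ O))).map φ)).symm ≪≫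
        pullInclConstIso hsub e⟩⟩

/-- The endomorphism of the stalk of a constant sheaf given by an endomorphism of the sheaf, seen
as an endomorphism of the module of values. -/
def stalkEnd {M : ModuleCat.{u} A} (e : constSheafOf M V ⟶ constSheafOf M V) (x : V) : M →ₗ[A] M :=
  let i : M ≃ₗ[A] (stalkAt A x).obj (constSheafOf M V) :=
    LinearEquiv.ofBijective (germAt (constSheafOf M V) ⊤ x trivial ∘ₗ constSec M V)
      (germAt_constSec_bijective M x)
  i.symm.toLinearMap ∘ₗ ((stalkAt A x).map e).hom ∘ₗ i.toLinearMap

lemma germAt_constSec_stalkEnd {M : ModuleCat.{u} A} (e : constSheafOf M V ⟶ constSheafOf M V)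
    (x : V) (m : M) :
    germAt (constSheafOf M V) ⊤ x trivial (constSec M V (stalkEnd e x m)) =
      germAt (constSheafOf M V) ⊤ x trivial (onSec e ⊤ (constSec M V m)) := by
  refine Eq.trans ?_ (stalkAt_map_germAt e ⊤ x trivial _)
  exact (LinearEquiv.ofBijective (germAt (constSheafOf M V) ⊤ x trivial ∘ₗ constSec M V)
      (germAt_constSec_bijective M x)).apply_symm_apply _

lemma stalkEnd_comp {M : ModuleCat.{u} A} (e e' : constSheafOf M V ⟶ constSheafOf M V)
    (x : V) : stalkEnd (e ≫ e') x = stalkEnd e' x ∘ₗ stalkEnd e x := by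
  ext m
  refine (germAt_constSec_bijective M x).1 ?_
  dsimp only [LinearMap.comp_apply]
  rw [germAt_constSec_stalkEnd, germAt_constSec_stalkEnd, onSec_comp]
  refine (stalkAt_map_germAt e' ⊤ x trivial _).symm.trans
    (Eq.trans ?_ (stalkAt_map_germAt e' ⊤ x trivial _))
  rw [germAt_constSec_stalkEnd]

/-- If `M` is finitely generated, then an endomorphism of the constant sheaf `M` is locally given
by an endomorphism of `M`. -/
lemma exists_res_constSec_stalkEnd {M : ModuleCat.{u} A} [Module.Finite A M]
    (e : constSheafOf M V ⟶ constSheafOf M V) (x : V) :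
    ∃ O : Opens V, x ∈ O ∧ ∀ m, res _ (le_top : O ≤ ⊤) (onSec e ⊤ (constSec M V m)) =
      res _ (le_top : O ≤ ⊤) (constSec M V (stalkEnd e x m)) := by
  obtain ⟨t, ht⟩ := Module.Finite.fg_top (R := A) (M := M)
  have key (s : Finset M) : ∃ O : Opens V, x ∈ O ∧ ∀ m ∈ s,
      res _ (le_top : O ≤ ⊤) (onSec e ⊤ (constSec M V m)) =
        res _ (le_top : O ≤ ⊤) (constSec M V (stalkEnd e x m)) := by
    classical
    induction s using Finset.induction_on with
    | empty => exact ⟨⊤, trivial, by simp⟩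
    | insert a s ha ih =>
      obtain ⟨O, hx, hO⟩ := ih
      obtain ⟨O', h', hx', hO'⟩ := exists_res_eq_of_germAt_eq (constSheafOf M V)
        (germAt_constSec_stalkEnd e x a).symm
      refine ⟨O ⊓ O', ⟨hx, hx'⟩, fun m hm ↦ ?_⟩
      rcases Finset.mem_insert.1 hm with rfl | hm
      · have := congrArg (res _ (inf_le_right : O ⊓ O' ≤ O')) hO'
        rwa [res_res, res_res] at this
      · have := congrArg (res _ (inf_le_left : O ⊓ O' ≤ O)) (hO m hm)
        rwa [res_res, res_res] at this
  obtain ⟨O, hx, hO⟩ := key t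
  refine ⟨O, hx, fun m ↦ ?_⟩
  have := LinearMap.ext_on (f := res _ (le_top : O ≤ ⊤) ∘ₗ onSec e ⊤ ∘ₗ constSec M V)
    (g := res _ (le_top : O ≤ ⊤) ∘ₗ constSec M V ∘ₗ stalkEnd e x) ht (fun m hm ↦ hO m hm)
  exact LinearMap.congr_fun this m

/-- The inverse image of an endomorphism of the constant sheaf `M` under a map with values in an
open subset where this endomorphism is given by an endomorphism `k` of `M`. -/
lemma pull_map_constSheafOf {Z : TopCat.{u}} (g : V ⟶ Z) {M : ModuleCat.{u} A}
    (e : constSheafOf M Z ⟶ constSheafOf M Z) (k : M →ₗ[A] M) (O : Opens Z) (hg : ∀ x, g x ∈ O)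
    (h : ∀ m, res _ (le_top : O ≤ ⊤) (onSec e ⊤ (constSec M Z m)) =
      res _ (le_top : O ≤ ⊤) (constSec M Z (k m))) :
    (pull A g).map e ≫ (pullConstIso g M).hom =
      (pullConstIso g M).hom ≫ constMap k V := by
  apply ((pullPushAdj A g).homEquiv _ _).injective
  rw [Adjunction.homEquiv_naturality_left, Adjunction.homEquiv_naturality_right,
    homEquiv_pullConstIso]
  refine constSheafOf_hom_ext fun m ↦ ?_
  rw [onSec_comp, onSec_comp, onSec_constSheafOfToPush]
  have h1 : onSec ((push A g).map (constMap k V)) ⊤ (constSec M V m) = constSec M V (k m) :=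
    onSec_constMap k m
  rw [h1]
  have htop : (⊤ : Opens V) ≤ (Opens.map g).obj O := fun x _ ↦ hg x
  have h2 := congrArg (onSec (constSheafOfToPush g M) O) (h m)
  rw [onSec_res, onSec_res, onSec_constSheafOfToPush] at h2
  have h3 := congrArg (res (constSheafOf M V) htop) h2
  have h4 (s : Sec ((push A g).obj (constSheafOf M V)) ⊤) :
      res (constSheafOf M V) htop (res ((push A g).obj (constSheafOf M V)) (le_top : O ≤ ⊤) s) =
        s :=
    (res_res (constSheafOf M V) (O := ⊤) le_top htop s).trans (res_self _ le_rfl s)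
  exact (h4 _).symm.trans (h3.trans (h4 _))

/-- Two splittings of the same idempotent are isomorphic. -/
def isoOfSplittings {C : Type*} [Category* C] {P Q R : C} (i : P ⟶ R) (r : R ⟶ P) (j : Q ⟶ R)
    (s : R ⟶ Q) (hi : i ≫ r = 𝟙 P) (hj : j ≫ s = 𝟙 Q) (h : r ≫ i = s ≫ j) : P ≅ Q where
  hom := i ≫ s
  inv := j ≫ r
  hom_inv_id := by
    rw [Category.assoc, ← Category.assoc s, ← h, Category.assoc, hi, Category.comp_id, hi]
  inv_hom_id := by
    rw [Category.assoc, ← Category.assoc r, h, Category.assoc, hj, Category.comp_id, hj]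

/-- A direct summand of a constructible sheaf is constructible. -/
lemma IsConstructible.of_retract {F G : Sh A V} (hF : IsConstructible F) (i : G ⟶ F) (r : F ⟶ G)
    (hir : i ≫ r = 𝟙 G) : IsConstructible G := by
  obtain ⟨ι, S, hS, hS', hfin, hloc, hF⟩ := hF
  refine ⟨ι, S, hS, hS', hfin, hloc, fun n s hs ↦ ?_⟩
  obtain ⟨O, hO, hsO, M, hM, ⟨e⟩⟩ := hF n s hs
  let T := S n ∩ O
  let x : TopCat.of T := ⟨s, hs, hsO⟩
  let i₁ : (pull A (incl T)).obj G ⟶ constSheafOf M (TopCat.of T) := (pull A (incl T)).map i ≫ e.hom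
  let r₁ : constSheafOf M (TopCat.of T) ⟶ (pull A (incl T)).obj G := e.inv ≫ (pull A (incl T)).map r
  have h₁ : i₁ ≫ r₁ = 𝟙 _ := by
    simp only [i₁, r₁, Category.assoc, Iso.hom_inv_id_assoc, ← Functor.map_comp, hir]
    exact CategoryTheory.Functor.map_id _ _
  -- `G` is the image of the idempotent `r₁ ≫ i₁` on the stratum near `s`, which is given by an
  -- idempotent `k` of `M` on a smaller neighbourhood
  obtain ⟨O', hx, hO'⟩ := exists_res_constSec_stalkEnd (r₁ ≫ i₁) x
  obtain ⟨O'', hO'', hO'eq⟩ := isOpen_induced_iff.1 O'.isOpen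
  let T' := S n ∩ (O ∩ O'')
  have hT : T' ⊆ T := Set.inter_subset_inter_right _ Set.inter_subset_left
  have hT' (y : TopCat.of T') : inclLE hT y ∈ O' := by
    change inclLE hT y ∈ (O' : Set (TopCat.of T))
    rw [← hO'eq]
    exact y.2.2.2
  have hsO'' : s ∈ O'' := by
    have : x ∈ (O' : Set (TopCat.of T)) := hx
    rwa [← hO'eq] at this
  let k := stalkEnd (r₁ ≫ i₁) x
  have hk : k ∘ₗ k = k := by
    rw [← stalkEnd_comp]
    congr 1
    rw [Category.assoc, ← Category.assoc i₁, h₁, Category.id_comp]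
  let N := ModuleCat.of A (LinearMap.range k)
  let c := pullConstIso (inclLE hT) M
  have hcomm := pull_map_constSheafOf (inclLE hT) (r₁ ≫ i₁) k O' hT' hO'
  refine ⟨O ∩ O'', hO.inter hO'', ⟨hsO, hsO''⟩, N, inferInstance, ⟨(pullInclIso G hT).symm ≪≫ ?_⟩⟩
  refine isoOfSplittings ((pull A (inclLE hT)).map i₁ ≫ c.hom) (c.inv ≫ (pull A (inclLE hT)).map r₁)
    (constMap (M := N) (LinearMap.range k).subtype (TopCat.of T'))
    (constMap (N := N) k.rangeRestrict (TopCat.of T')) ?_ ?_ ?_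
  · rw [Category.assoc, Iso.hom_inv_id_assoc, ← Functor.map_comp, h₁]
    exact CategoryTheory.Functor.map_id _ _
  · refine constSheafOf_hom_ext ?_
    rintro ⟨_, m, rfl⟩
    rw [onSec_comp, onSec_constMap, onSec_constMap, onSec_id]
    congr 1
    exact Subtype.ext (LinearMap.congr_fun hk m)
  · have hfac : constMap k (TopCat.of T') = constMap (N := N) k.rangeRestrict (TopCat.of T') ≫
        constMap (M := N) (LinearMap.range k).subtype (TopCat.of T') := by
      refine constSheafOf_hom_ext fun m ↦ ?_
      rw [onSec_comp, onSec_constMap, onSec_constMap, onSec_constMap]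
      rfl
    rw [Category.assoc, ← Category.assoc ((pull A (inclLE hT)).map r₁), ← Functor.map_comp,
      Iso.inv_comp_eq, ← hfac]
    exact hcomm

end Constructible

/-! ### Complexes with bounded constructible cohomology -/

section ConstructibleComplexes

variable {A : Type u} [CommRing A] {V : TopCat.{u}}

lemma isLE_iff_isZero_homology (K : DPlus A V) (n : ℤ) :
    K.IsLE n ↔ ∀ i, n < i →
      IsZero ((DerivedCategory.Plus.homologyFunctor (Sh A V) i).obj K) := by
  rw [← DerivedCategory.Plus.isLE_ι_obj_iff, DerivedCategory.isLE_iff]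
  rfl

lemma Dbc.of_retract {K L : DPlus A V} (hK : Dbc A V K) (i : L ⟶ K) (r : K ⟶ L)
    (hir : i ≫ r = 𝟙 L) : Dbc A V L := by
  have h (n : ℤ) : (DerivedCategory.Plus.homologyFunctor (Sh A V) n).map i ≫
      (DerivedCategory.Plus.homologyFunctor (Sh A V) n).map r = 𝟙 _ := by
    rw [← Functor.map_comp, hir, CategoryTheory.Functor.map_id]
  obtain ⟨⟨m, hm⟩, hc⟩ := hK
  refine ⟨⟨m, (isLE_iff_isZero_homology L m).2 fun n hn ↦ ?_⟩, fun n ↦ (hc n).of_retract _ _ (h n)⟩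
  rw [IsZero.iff_id_eq_zero, ← h n,
    ((isLE_iff_isZero_homology K m).1 hm n hn).eq_of_tgt
      ((DerivedCategory.Plus.homologyFunctor (Sh A V) n).map i) 0, zero_comp]

/-- Bounded constructible cohomology is transported along a morphism which is an isomorphism on the
stalks of the cohomology over a closed subset, to an object without cohomology elsewhere. -/
lemma Dbc.of_isIso_stalkH {K L : DPlus A V} (hK : Dbc A V K) (φ : K ⟶ L) {W : Set V}
    (hW : IsClosed W) (h : ∀ n, ∀ x ∈ W, IsIso ((stalkH A n x).map φ))
    (h' : ∀ n, ∀ x ∉ W, IsZero ((stalkH A n x).obj L)) : Dbc A V L := by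
  obtain ⟨⟨m, hm⟩, hc⟩ := hK
  refine ⟨⟨m, (isLE_iff_isZero_homology L m).2 fun n hn ↦ isZero_of_isZero_stalkAt fun x ↦ ?_⟩,
    fun n ↦ (hc n).of_isIso_stalkAt _ hW (h n) (h' n)⟩
  by_cases hx : x ∈ W
  · have := h n x hx
    exact ((stalkAt A x).map_isZero ((isLE_iff_isZero_homology K m).1 hm n hn)).of_iso
      (asIso ((stalkH A n x).map φ)).symm
  · exact h' n x hx

lemma dbc_AA (A : Type u) [CommRing A] (V : TopCat.{u}) : Dbc A V (AA A V) := by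
  refine ⟨⟨0, inferInstance⟩, fun n ↦ ?_⟩
  by_cases hn : n = 0
  · subst hn
    exact (isConstructible_constSheaf A V).of_retract _ _
      ((homologyZeroIso A V).app (constSheaf A V)).hom_inv_id
  -- the zero sheaf is a direct summand of `A_V`
  · exact (isConstructible_constSheaf A V).of_retract 0 0
      ((isZero_homology_inDegreeZero (constSheaf A V) hn).eq_of_src _ _)

end ConstructibleComplexes

end

end Bivariant

/-- The three conditions are equivalent in `D⁺(Y)`, for every such `f`. If `Rf_* A_X` is in the full
subcategory `D^b_c(Y)`, as the notation `Hom_{D^b_c(Y)}(Rf_* A_X, A_Y)` presupposes, then so are all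
the objects occurring in the three conditions, which are thus equivalent in `D^b_c(Y)`. -/
theorem theorem1p1 (A : Type u) [CommRing A] [IsNoetherianRing A] (X Y : TopCat.{u})
    (hX : Bivariant.ClosedInEuclidean X) (hY : Bivariant.ClosedInEuclidean Y)
    [PathConnectedSpace Y] (f : X ⟶ Y) (hf : IsProperMap f)
    (U W : Set Y) (hU : IsOpen U) (hUne : U.Nonempty)
    (hfU : IsHomeomorph (U.restrictPreimage f)) (hW : W = Uᶜ) :
    List.TFAE [
      ∃ θ : (Bivariant.Rpush A f).obj (Bivariant.AA A X) ⟶ Bivariant.AA A Y,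
        Bivariant.HasDegreeOne f θ,
      Nonempty ((Bivariant.Rpush A f).obj (Bivariant.AA A X) ⊞ Bivariant.AAOn A W ≅
        (Bivariant.Rpush A f).obj (Bivariant.AAOn A (f ⁻¹' W)) ⊞ Bivariant.AA A Y),
      ∃ K : Bivariant.DPlus A Y,
        Nonempty ((Bivariant.Rpush A f).obj (Bivariant.AA A X) ≅ Bivariant.AA A Y ⊞ K)] ∧
    (Bivariant.Dbc A Y ((Bivariant.Rpush A f).obj (Bivariant.AA A X)) →
      Bivariant.Dbc A Y (Bivariant.AA A Y) ∧ Bivariant.Dbc A Y (Bivariant.AAOn A W) ∧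
      Bivariant.Dbc A Y ((Bivariant.Rpush A f).obj (Bivariant.AAOn A (f ⁻¹' W))) ∧
      ∀ K : Bivariant.DPlus A Y,
        Nonempty ((Bivariant.Rpush A f).obj (Bivariant.AA A X) ≅ Bivariant.AA A Y ⊞ K) →
          Bivariant.Dbc A Y K) := by
  subst hW
  obtain ⟨N, e, he⟩ := hX
  have : T3Space X := he.isEmbedding.t3Space
  have hWc : IsClosed Uᶜ := hU.isClosed_compl
  -- the fibres of `f` over `U` are single points
  have hfW (y : Y) (hy : y ∉ Uᶜ) : ∃ x, f ⁻¹' {y} = {x} := by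
    obtain ⟨x, hx⟩ := hfU.surjective ⟨y, not_not.1 hy⟩
    have hx' : f x.1 = y := congrArg Subtype.val hx
    refine ⟨x.1, Set.eq_singleton_iff_unique_mem.2 ⟨hx', fun x' (hx'' : f x' = y) ↦ ?_⟩⟩
    have hU' : f x' ∈ U := hx'' ▸ not_not.1 hy
    exact congrArg Subtype.val (hfU.injective (a₁ := ⟨x', hU'⟩) (a₂ := x)
      (Subtype.ext (hx''.trans hx'.symm)))
  refine ⟨Bivariant.tfae_hasDegreeOne hf hWc hfW (by rwa [compl_compl]), fun hR ↦
    ⟨Bivariant.dbc_AA A Y, ?_, ?_, fun K ⟨e⟩ ↦ ?_⟩⟩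
  · exact (Bivariant.dbc_AA A Y).of_isIso_stalkH (Bivariant.toConstOn A Uᶜ) hWc
      (fun n _ hy ↦ Bivariant.isIso_stalkH_toConstOn hWc hy n)
      (fun n _ hy ↦ Bivariant.isZero_stalkH_AAOn hWc hy n)
  · exact hR.of_isIso_stalkH (Bivariant.RpushToConstOn A f (f ⁻¹' Uᶜ)) hWc
      (fun n _ hy ↦ Bivariant.isIso_stalkH_RpushToConstOn hf hWc hy n)
      (fun n _ hy ↦ Bivariant.isZero_stalkH_Rpush_AAOn hf hWc hy n)
  · exact hR.of_retract (biprod.inr ≫ e.inv) (e.hom ≫ biprod.snd) (by simp)
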